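/- **Definitions.** Let $n,r\ge 0$ be integers. A *ray geometry of rank $r$* on $\mathbb R^n$ is given by a basis $(e_1,\dots,e_n)$ of $\mathbb R^n$, real exponents $d_{j,i}$ ($1\le j\le r$, $1\le i\le n$) and a compact subgroup $K\subset \mathrm{GL}(\mathbb R^n)$ such that the map sending $(\beta_1,\dots,\beta_r)\in(\mathbb R_{>0})^r$ to the transformation that is diagonal in the basis $(e_i)$ with $i$-th diagonal entry $\beta_1^{d_{1,i}}\cdots\beta_r^{d_{r,i}}$ is injective, and $K$ centralizes its image $A\cong(\mathbb R_{>0})^r$. Its group is $G=\mathbb R^n\rtimes KA$, the group of affine transformations of $\mathbb R^n$ whose linear part lies in $KA$. Let $M$ be a closed (compact, without boundary) connected smooth $n$-manifold with universal covering $\pi\colon\widetilde M\to M$, on which $\pi_1(M)$ acts by deck transformations. A *ray structure of rank $r$* on $M$ is a pair $(D,\rho)$, where $D\colon\widetilde M\to\mathbb R^n$ is a local diffeomorphism and $\rho\colon\pi_1(M)\to G$ is a morphism into the group of a ray geometry of rank $r$, with $D(\gamma x)=\rho(\gamma)D(x)$ for all $\gamma\in\pi_1(M)$, $x\in\widetilde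 M$. It is *complete* if $D$ is a diffeomorphism onto $\mathbb R^n$. Let $\Gamma=\rho(\pi_1(M))$ and let $N(\Gamma)$ be its normalizer in $G$. An *automorphism* of $M$ is a diffeomorphism $f\colon M\to M$ such that for every lift $\widetilde f\colon\widetilde M\to\widetilde M$ of $f$ there is a unique $\chi(\widetilde f)\in N(\Gamma)$ with $D(\widetilde f(x))=\chi(\widetilde f)D(x)$ for all $x\in\widetilde M$. The automorphisms form a group $\mathrm{Aut}(M)$, which carries the compact-open topology; it *acts properly* on $M$ if the map $\mathrm{Aut}(M)\times M\to M\times M$, $(f,x)\mapsto(f(x),x)$, is proper. **Theorem.** 1. Let $M$ be a closed connected manifold with a ray structure of rank one. If $\mathrm{Aut}(M)$ does not act properly on $M$, then $M$ is complete. 2. This fails in rank two: there is a closed connected manifold with a ray structure of rank two that is not complete and whose automorphism group does not act properly on it. -/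

import Mathlib

open scoped Manifold ContDiff Topology

noncomputable section

namespace RayManifold

/-- The model space `ℝⁿ`. -/
abbrev Model (n : ℕ) : Type := EuclideanSpace ℝ (Fin n)

/-- The group of affine transformations of `ℝⁿ`. -/
abbrev Aff (n : ℕ) : Type := Model n ≃ᵃ[ℝ] Model n

/-! ### Ray geometries -/

/-- The subgroup of `GL(ℝⁿ)` of all transformations that are diagonal in the basis `b`, with
diagonal entries `β₁ ^ d₁ᵢ ⋯ βᵣ ^ dᵣᵢ` for some `β₁, …, βᵣ > 0`. -/
def diagonalGroup {n r : ℕ} (b : Module.Basis (Fin n) ℝ (Model n)) (d : Fin r → Fin n → ℝ) :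
    Subgroup (Model n ≃ₗ[ℝ] Model n) where
  carrier := {a | ∃ β : Fin r → ℝ, (∀ j, 0 < β j) ∧ ∀ i, a (b i) = (∏ j, β j ^ d j i) • b i}
  one_mem' := ⟨fun _ => 1, fun _ => one_pos, fun i => by simp⟩
  mul_mem' := by
    rintro a a' ⟨β, hβ, ha⟩ ⟨β', hβ', ha'⟩
    refine ⟨fun j => β j * β' j, fun j => mul_pos (hβ j) (hβ' j), fun i => ?_⟩
    have h : ∀ j, (β j * β' j) ^ d j i = β j ^ d j i * β' j ^ d j i := fun j =>
      Real.mul_rpow (hβ j).le (hβ' j).le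
    simp only [h, Finset.prod_mul_distrib, LinearEquiv.mul_apply, ha', map_smul, ha, smul_smul]
    rw [mul_comm]
  inv_mem' := by
    rintro a ⟨β, hβ, ha⟩
    refine ⟨fun j => (β j)⁻¹, fun j => inv_pos.2 (hβ j), fun i => ?_⟩
    have h : ∀ j, (β j)⁻¹ ^ d j i = (β j ^ d j i)⁻¹ := fun j => Real.inv_rpow (hβ j).le _
    have hne : (∏ j, β j ^ d j i) ≠ 0 :=
      Finset.prod_ne_zero_iff.2 fun j _ => (Real.rpow_pos_of_pos (hβ j) _).ne'
    simp only [h, Finset.prod_inv_distrib]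
    apply a.injective
    have h1 : a (a⁻¹ (b i)) = b i := by
      rw [← LinearEquiv.mul_apply, mul_inv_cancel, LinearEquiv.coe_one, id]
    rw [h1, map_smul, ha, smul_smul, inv_mul_cancel₀ hne, one_smul]

/-- A ray geometry of rank `r` on `ℝⁿ`: a group `A` that is diagonal in a fixed basis and is
parametrized isomorphically by `(ℝ_{>0})^r`, with a compact group `K` of linear transformations
that centralizes `A`. -/
structure RayGeometry (n r : ℕ) where
  /-- the fixed basis in which `A` is diagonal -/
  basis : Module.Basis (Fin n) ℝ (Model n)
  /-- the exponents of the diagonal entries -/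
  exponent : Fin r → Fin n → ℝ
  /-- the parametrization of `A` by `(ℝ_{>0})^r` is injective, hence an isomorphism -/
  injOn_param : Set.InjOn (fun (β : Fin r → ℝ) (i : Fin n) => ∏ j, β j ^ exponent j i)
    {β | ∀ j, 0 < β j}
  /-- the compact group of rotations -/
  K : Subgroup (Model n ≃ₗ[ℝ] Model n)
  /-- `K` is compact, for the topology of `End(ℝⁿ)` -/
  isCompact_K : IsCompact ((fun k : Model n ≃ₗ[ℝ] Model n =>
    LinearMap.toContinuousLinearMap (k : Model n →ₗ[ℝ] Model n)) '' (K : Set _))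
  /-- `K` centralizes `A` -/
  commute : ∀ k ∈ K, ∀ a ∈ diagonalGroup basis exponent, k * a = a * k

/-- The diagonal group `A` of a ray geometry. -/
def RayGeometry.A {n r : ℕ} (𝒢 : RayGeometry n r) : Subgroup (Model n ≃ₗ[ℝ] Model n) :=
  diagonalGroup 𝒢.basis 𝒢.exponent

/-- The group `G = ℝⁿ ⋊ KA` of a ray geometry: the affine transformations whose linear part
is in `KA`. (Since `K` and `A` commute, the subgroup they generate is the set of products.) -/
def RayGeometry.G {n r : ℕ} (𝒢 : RayGeometry n r) : Subgroup (Aff n) :=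
  (𝒢.K ⊔ 𝒢.A).comap AffineEquiv.linearHom

/-! ### Universal coverings and `(G, ℝⁿ)`-structures -/

section Structures

universe u v

variable {n : ℕ} {M : Type u} {N : Type v}
  [TopologicalSpace M] [ChartedSpace (Model n) M]
  [TopologicalSpace N] [ChartedSpace (Model n) N]

/-- A smooth universal covering `N → M`. -/
structure UniversalCovering (n : ℕ) (N : Type v) (M : Type u)
    [TopologicalSpace M] [ChartedSpace (Model n) M]
    [TopologicalSpace N] [ChartedSpace (Model n) N] where
  /-- the projection -/
  proj : N → M
  simplyConnected : SimplyConnectedSpace N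
  surjective : Function.Surjective proj
  isCoveringMap : IsCoveringMap proj
  isLocalDiffeomorph : IsLocalDiffeomorph 𝓘(ℝ, Model n) 𝓘(ℝ, Model n) ∞ proj

/-- The group of deck transformations, that is, `π₁(M)` acting on the universal cover. -/
def UniversalCovering.deck (π : UniversalCovering n N M) : Subgroup (N ≃ₜ N) where
  carrier := {γ | ∀ x, π.proj (γ x) = π.proj x}
  one_mem' := fun _ => rfl
  mul_mem' := fun {a b} ha hb x => (ha (b x)).trans (hb x)
  inv_mem' := fun {a} ha x => by
    have := ha (a⁻¹ x)
    simpa using this.symm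

/-- `F` is a lift of `f` to the universal cover. -/
def UniversalCovering.IsLift (π : UniversalCovering n N M) (F : N → N) (f : M → M) : Prop :=
  Continuous F ∧ ∀ x, π.proj (F x) = f (π.proj x)

/-- A `(G, ℝⁿ)`-structure on `M`: a developing map and a holonomy morphism. -/
structure GStructure (G : Subgroup (Aff n)) (π : UniversalCovering n N M) where
  /-- the developing map -/
  dev : N → Model n
  isLocalDiffeomorph_dev : IsLocalDiffeomorph 𝓘(ℝ, Model n) 𝓘(ℝ, Model n) ∞ dev
  /-- the holonomy morphism -/
  hol : π.deck →* G
  dev_deck : ∀ (γ : π.deck) (x : N), dev ((γ : N ≃ₜ N) x) = (hol γ : Aff n) (dev x)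

variable {G : Subgroup (Aff n)} {π : UniversalCovering n N M}

/-- The structure is complete if the developing map is a diffeomorphism onto `ℝⁿ`. -/
def GStructure.IsComplete (S : GStructure G π) : Prop :=
  ∃ Φ : N ≃ₘ⟮𝓘(ℝ, Model n), 𝓘(ℝ, Model n)⟯ Model n, ⇑Φ = S.dev

/-- The normalizer in `G` of the holonomy group. -/
def GStructure.normalizer (S : GStructure G π) : Subgroup G :=
  Subgroup.normalizer (S.hol.range : Set G)

/-- `f` is an automorphism: a diffeomorphism, every lift of which is developed to a unique
element of the normalizer of the holonomy group. -/
structure GStructure.IsAutomorphism (S : GStructure G π) (f : M ≃ₜ M) : Prop where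
  contMDiff : ContMDiff 𝓘(ℝ, Model n) 𝓘(ℝ, Model n) ∞ f
  contMDiff_symm : ContMDiff 𝓘(ℝ, Model n) 𝓘(ℝ, Model n) ∞ f.symm
  develops : ∀ F : N → N, π.IsLift F f →
    ∃! χ : S.normalizer, ∀ x, S.dev (F x) = ((χ : G) : Aff n) (S.dev x)

/-! #### Automorphisms form a group -/

theorem UniversalCovering.exists_lift (π : UniversalCovering n N M) (f : M ≃ₜ M) {x y : N}
    (h : π.proj y = f (π.proj x)) : ∃ F, π.IsLift F f ∧ F x = y := by
  have := π.simplyConnected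
  have : LocallyPathConnectedSpace N := ChartedSpace.locallyPathConnectedSpace (Model n) N
  obtain ⟨F, ⟨h1, h2⟩, -⟩ := π.isCoveringMap.existsUnique_continuousMap_lifts
    ⟨fun x => f (π.proj x), f.continuous.comp π.isCoveringMap.continuous⟩ x y h
  exact ⟨F, ⟨F.continuous, fun x => congrFun h2 x⟩, h1⟩

theorem UniversalCovering.lift_id_eq (π : UniversalCovering n N M) {F : N → N}
    (hF : π.IsLift F id) {x : N} (h : F x = x) : ∀ y, F y = y := by
  have := π.simplyConnected
  exact fun y => congrFun (π.isCoveringMap.eq_of_comp_eq hF.1 continuous_id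
    (funext fun z => hF.2 z) x h) y

theorem UniversalCovering.exists_lift_inverse (π : UniversalCovering n N M) (f : M ≃ₜ M)
    {F : N → N} (hF : π.IsLift F f) :
    ∃ H, π.IsLift H f.symm ∧ (∀ x, H (F x) = x) ∧ ∀ x, F (H x) = x := by
  have := π.simplyConnected
  obtain ⟨x⟩ : Nonempty N := inferInstance
  obtain ⟨H, hH, hx⟩ := π.exists_lift f.symm (x := F x) (y := x) (by simp [hF.2])
  refine ⟨H, hH, π.lift_id_eq (F := fun x => H (F x)) ⟨hH.1.comp hF.1, fun y => ?_⟩ (x := x) hx,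
    π.lift_id_eq (F := fun x => F (H x)) ⟨hF.1.comp hH.1, fun y => ?_⟩ (x := F x) (by rw [hx])⟩
  · simp [hH.2, hF.2]
  · simp [hH.2, hF.2]

theorem GStructure.eq_of_dev (S : GStructure G π) {g g' : Aff n}
    (h : ∀ x, g (S.dev x) = g' (S.dev x)) : g = g' := by
  have := π.simplyConnected
  have hspan : affineSpan ℝ (Set.range S.dev) = ⊤ :=
    S.isLocalDiffeomorph_dev.isOpen_range.affineSpan_eq_top (Set.range_nonempty _)
  have h2 : (g : Model n →ᵃ[ℝ] Model n) = (g' : Model n →ᵃ[ℝ] Model n) := by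
    apply AffineMap.ext_on hspan
    rintro _ ⟨x, rfl⟩
    exact h x
  ext1 x
  exact congrArg (fun a : Model n →ᵃ[ℝ] Model n => a x) h2

theorem GStructure.existsUnique_of_exists (S : GStructure G π) {F : N → N} (χ : S.normalizer)
    (h : ∀ x, S.dev (F x) = ((χ : G) : Aff n) (S.dev x)) :
    ∃! χ : S.normalizer, ∀ x, S.dev (F x) = ((χ : G) : Aff n) (S.dev x) :=
  ⟨χ, h, fun _ h' => Subtype.ext (Subtype.ext (S.eq_of_dev fun x => (h' x).symm.trans (h x)))⟩

/-- The automorphism group of the structure. -/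
def GStructure.Aut (S : GStructure G π) : Subgroup (M ≃ₜ M) where
  carrier := {f | S.IsAutomorphism f}
  one_mem' := by
    refine ⟨contMDiff_id, contMDiff_id, fun F hF => ?_⟩
    obtain ⟨H, hH, h1, h2⟩ := π.exists_lift_inverse 1 hF
    let γ : π.deck := ⟨⟨⟨F, H, h1, h2⟩, hF.1, hH.1⟩, fun x => hF.2 x⟩
    exact S.existsUnique_of_exists
      ⟨S.hol γ, Subgroup.le_normalizer (H := S.hol.range) ⟨γ, rfl⟩⟩ (S.dev_deck γ)
  mul_mem' := by
    rintro f f' hf hf'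
    refine ⟨hf.contMDiff.comp hf'.contMDiff, hf'.contMDiff_symm.comp hf.contMDiff_symm,
      fun F hF => ?_⟩
    have := π.simplyConnected
    obtain ⟨x⟩ : Nonempty N := inferInstance
    obtain ⟨y, hy⟩ := π.surjective (f' (π.proj x))
    obtain ⟨F', hF', -⟩ := π.exists_lift f' hy
    obtain ⟨H, hH, h1, -⟩ := π.exists_lift_inverse f' hF'
    obtain ⟨χ', hχ', -⟩ := hf'.develops F' hF'
    obtain ⟨χ, hχ, -⟩ := hf.develops (fun x => F (H x)) ⟨hF.1.comp hH.1, fun y => by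
      simp [hF.2, hH.2]⟩
    refine S.existsUnique_of_exists (χ * χ') fun z => ?_
    have h3 := hχ (F' z)
    rw [h1, hχ'] at h3
    exact h3
  inv_mem' := by
    rintro f hf
    refine ⟨hf.contMDiff_symm, hf.contMDiff, fun F hF => ?_⟩
    obtain ⟨H', hH', h1', -⟩ := π.exists_lift_inverse f⁻¹ hF
    obtain ⟨χ, hχ, -⟩ := hf.develops H' hH'
    refine S.existsUnique_of_exists χ⁻¹ fun z => ?_
    have h3 := hχ (F z)
    rw [h1'] at h3
    rw [h3]
    exact (AffineEquiv.symm_apply_apply ((χ : G) : Aff n) (S.dev (F z))).symm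

/-- The tautological action of the automorphism group on the manifold. -/
instance GStructure.instMulActionAut (S : GStructure G π) : MulAction S.Aut M where
  smul f x := (f : M ≃ₜ M) x
  one_smul _ := rfl
  mul_smul _ _ _ := rfl

/-- The automorphism group carries the compact-open topology. -/
instance GStructure.instTopologicalSpaceAut (S : GStructure G π) : TopologicalSpace S.Aut :=
  TopologicalSpace.induced (fun f => ((f : M ≃ₜ M) : C(M, M))) inferInstance

/-- The automorphism group acts properly on the manifold (in the sense of Bourbaki). -/
def GStructure.AutActsProperly (S : GStructure G π) : Prop :=
  ProperSMul S.Aut M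

end Structures

end RayManifold

end

/-!
Let the rank be one. In the coordinates of the basis, the developing map `D` is a local
homeomorphism that intertwines `π₁(M)` with products of translations, rotations and dilations
`diag(s ^ dᵢ)`. Say that a point `x` sees a vector `v` if the segment from `D x` to `D x + v` lifts
to a path from `x`. If a deck transformation that takes `x` into a compact fundamental set dilates
by `s⁻¹`, then `x` sees a box with sides proportional to `s ^ dᵢ`; so `s` measures how far `x`
sees. Suppose that `x` does not see some expanded vector, one with components only in the
directions with `dᵢ > 0`. Along the part of the segment that lifts, `s` tends to zero. There the
boxes become arbitrarily long in the contracted directions, those with `dᵢ < 0`, and it follows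
that `x` sees all contracted vectors. Likewise, whether a point sees all expanded vectors does not
depend on the point.

Hence either some point sees every vector, in which case `D` is a bijection and `M` is complete,
or, after replacing `d` by `-d` if necessary, no point of the fundamental set sees arbitrarily far
in the expanded directions. In the latter case a map that respects the structure and takes a point
of the fundamental set into it has its dilation ratio in a fixed compact interval. Lifts of
automorphisms chosen in this way are equicontinuous, their limits are again lifts of automorphisms,
and so `Aut(M)` is compact and acts properly.

In rank two, let `φ` be the golden ratio, `ψ` its conjugate, and embed `ℤ[φ]` in `ℝ²` by its two
real places. The torus `ℝ³ / (ℤ × ℤ[φ])` has a ray structure of rank two whose developing map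
`(t, y, z) ↦ (eᵗ, y, z)` has a half space as its image. The automorphism induced by
`diag(1, φ², ψ²)` has a fixed point with a nontrivial unstable set, so its powers do not act
properly.
-/

noncomputable section

namespace RayManifold

open Set Filter

/-! ### Lifting segments through a local homeomorphism -/

section Segments

open unitInterval

variable {N E : Type*} [TopologicalSpace N] [NormedAddCommGroup E] [NormedSpace ℝ E]

/-- The segment from `D x` to `D x + v` lifts through `D` to a path from `x` to `y`. -/
def Reach (D : N → E) (x : N) (v : E) (y : N) : Prop :=
  ∃ γ : I → N, Continuous γ ∧ γ 0 = x ∧ γ 1 = y ∧ ∀ t : I, D (γ t) = D x + (t : ℝ) • v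

/-- Visibility: the segment from `D x` to `D x + v` lifts through `D` to a path that starts
at `x`. -/
def Sees (D : N → E) (x : N) (v : E) : Prop := ∃ y, Reach D x v y

variable {D : N → E} {x y z : N} {u v w : E}

theorem Reach.sees (h : Reach D x v y) : Sees D x v := ⟨y, h⟩

theorem Reach.apply_eq (h : Reach D x v y) : D y = D x + v := by
  obtain ⟨γ, -, -, rfl, h⟩ := h
  simpa using h 1

theorem Reach.zero (x : N) : Reach D x 0 x :=
  ⟨fun _ => x, continuous_const, rfl, rfl, fun t => by simp⟩

theorem Reach.symm (h : Reach D x v y) : Reach D y (-v) x := by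
  have hy := h.apply_eq
  obtain ⟨γ, hγ, h0, h1, h⟩ := h
  refine ⟨fun t => γ (σ t), hγ.comp continuous_symm, by simpa, by simpa, fun t => ?_⟩
  rw [h, hy, coe_symm_eq]
  module

theorem Reach.of_path {γ : I → N} (hγ : Continuous γ) {e : E}
    (h : ∀ t : I, D (γ t) = e + (t : ℝ) • v) (s t : I) :
    Reach D (γ s) (((t : ℝ) - s) • v) (γ t) := by
  have hmem : ∀ r : I, (1 - (r : ℝ)) * s + r * t ∈ I := fun r =>
    convex_Icc (0 : ℝ) 1 s.2 t.2 (by linarith [r.2.2]) r.2.1 (by ring)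
  refine ⟨fun r => γ ⟨(1 - (r : ℝ)) * s + r * t, hmem r⟩, hγ.comp (by fun_prop), by simp, by simp,
    fun r => ?_⟩
  rw [h, h]
  module

theorem Reach.exists_path (h : Reach D x v y) : ∃ γ : I → N, Continuous γ ∧ γ 0 = x ∧ γ 1 = y ∧
    (∀ t : I, Reach D x ((t : ℝ) • v) (γ t)) ∧
    ∀ s t : I, Reach D (γ s) (((t : ℝ) - s) • v) (γ t) := by
  obtain ⟨γ, hγ, rfl, rfl, h⟩ := h
  exact ⟨γ, hγ, rfl, rfl, fun t => by simpa using Reach.of_path hγ h 0 t, Reach.of_path hγ h⟩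

theorem Reach.exists_between (h : Reach D x v y) {t : ℝ} (ht : t ∈ Icc (0 : ℝ) 1) :
    ∃ z, Reach D x (t • v) z ∧ Reach D z ((1 - t) • v) y := by
  obtain ⟨γ, -, -, rfl, hx, h⟩ := h.exists_path
  exact ⟨γ ⟨t, ht⟩, hx ⟨t, ht⟩, by simpa using h ⟨t, ht⟩ 1⟩

theorem Sees.smul (h : Sees D x v) {t : ℝ} (ht : t ∈ Icc (0 : ℝ) 1) : Sees D x (t • v) := by
  obtain ⟨y, h⟩ := h
  obtain ⟨z, hz, -⟩ := h.exists_between ht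
  exact hz.sees

theorem Reach.of_map {N' E' : Type*} [TopologicalSpace N'] [NormedAddCommGroup E']
    [NormedSpace ℝ E'] {D' : N' → E'} {F : N ≃ₜ N'} {L : E →ₗ[ℝ] E'} (hinj : Function.Injective L)
    (hL : ∀ x y, D' (F y) - D' (F x) = L (D y - D x)) {y : N'} (h : Reach D' (F x) (L v) y) :
    Reach D x v (F.symm y) := by
  obtain ⟨γ, hγ, h0, h1, h⟩ := h
  refine ⟨fun t => F.symm (γ t), F.symm.continuous.comp hγ, by simp [h0], by simp [h1],
    fun t => ?_⟩
  have : L (D (F.symm (γ t)) - D x) = L ((t : ℝ) • v) := by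
    rw [← hL, F.apply_symm_apply, h, map_smul, add_sub_cancel_left]
  rw [← hinj this, add_sub_cancel]

theorem Reach.concat {t : ℝ} (ht0 : 0 < t) (ht1 : t < 1) (h : Reach D x (t • v) y)
    (h' : Reach D y ((1 - t) • v) z) : Reach D x v z := by
  have hDy := h.apply_eq
  obtain ⟨γ, hγc, hγ0, hγ1, hγ⟩ := h
  obtain ⟨γ', hγc', hγ0', hγ1', hγ'⟩ := h'
  have ht1' : (0 : ℝ) < 1 - t := by linarith
  refine ⟨fun r => if (r : ℝ) ≤ t then γ (projIcc 0 1 zero_le_one (r / t))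
    else γ' (projIcc 0 1 zero_le_one ((r - t) / (1 - t))), ?_, ?_, ?_, fun r => ?_⟩
  · refine Continuous.if_le (hγc.comp (by fun_prop)) (hγc'.comp (by fun_prop)) (by fun_prop)
      (by fun_prop) fun r hr => ?_
    rw [hr, div_self ht0.ne', sub_self, zero_div, projIcc_right, projIcc_left]
    exact hγ1.trans hγ0'.symm
  · simp [ht0.le, hγ0]
  · simp [ht1.not_ge, div_self ht1'.ne', hγ1']
  · by_cases hr : (r : ℝ) ≤ t
    · have hmem : (r : ℝ) / t ∈ Icc (0 : ℝ) 1 := ⟨div_nonneg r.2.1 ht0.le, (div_le_one ht0).2 hr⟩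
      simp only [if_pos hr]
      rw [hγ, projIcc_of_mem _ hmem, smul_smul, div_mul_cancel₀ _ ht0.ne']
    · push Not at hr
      have hmem : ((r : ℝ) - t) / (1 - t) ∈ Icc (0 : ℝ) 1 :=
        ⟨div_nonneg (by linarith) ht1'.le, (div_le_one ht1').2 (by linarith [r.2.2])⟩
      simp only [if_neg hr.not_ge]
      rw [hγ', projIcc_of_mem _ hmem, smul_smul, div_mul_cancel₀ _ ht1'.ne', hDy]
      module

theorem reach_symm_of_mem_ball (e : OpenPartialHomeomorph N E) {c : E} {r : ℝ}
    (hball : Metric.ball c r ⊆ e.target) (hx : x ∈ e.source) (hxc : e x ∈ Metric.ball c r)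
    (hvc : e x + v ∈ Metric.ball c r) : Reach e x v (e.symm (e x + v)) := by
  have htarget : ∀ t ∈ Icc (0 : ℝ) 1, e x + t • v ∈ e.target := fun t ht => by
    have := (convex_ball c r).add_smul_sub_mem hxc hvc ht
    rw [add_sub_cancel_left] at this
    exact hball this
  exact ⟨fun t => e.symm (e x + (t : ℝ) • v),
    e.continuousOn_symm.comp_continuous (by fun_prop) fun t => htarget t t.2,
    by simp [e.left_inv hx], by simp, fun t => e.right_inv (htarget t t.2)⟩

section IsLocalHomeomorph

variable (hD : IsLocalHomeomorph D)
include hD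

theorem exists_nhds_reach (x : N) {W : Set N} (hW : W ∈ 𝓝 x) : ∃ δ > 0, ∃ U ∈ 𝓝 x,
    (∀ z ∈ U, ∀ v, ‖v‖ < δ → ∃ y ∈ W, Reach D z v y) ∧
    ∀ z ∈ U, ∀ z' ∈ U, Reach D z (D z' - D z) z' := by
  obtain ⟨e, hxe, rfl⟩ := hD x
  obtain ⟨V, hVW, hV, hxV⟩ := mem_nhds_iff.1 hW
  have himage : e '' (e.source ∩ V) ∈ 𝓝 (e x) :=
    (e.isOpen_image_source_inter hV).mem_nhds ⟨x, ⟨hxe, hxV⟩, rfl⟩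
  obtain ⟨r, hr, hball⟩ := Metric.mem_nhds_iff.1 himage
  have htarget : Metric.ball (e x) r ⊆ e.target := fun c hc => by
    obtain ⟨a, ha, rfl⟩ := hball hc
    exact e.map_source ha.1
  have hhalf := Metric.ball_subset_ball (x := e x) (half_le_self hr.le)
  refine ⟨r / 2, half_pos hr, e.source ∩ e ⁻¹' Metric.ball (e x) (r / 2), ?_, ?_, ?_⟩
  · exact inter_mem (e.open_source.mem_nhds hxe)
      ((e.continuousAt hxe).preimage_mem_nhds (Metric.ball_mem_nhds _ (half_pos hr)))
  · rintro z ⟨hz, hzr⟩ v hv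
    have hvr : e z + v ∈ Metric.ball (e x) r := by
      rw [mem_preimage, mem_ball_iff_norm] at hzr
      rw [mem_ball_iff_norm, add_sub_right_comm]
      linarith [norm_add_le (e z - e x) v]
    refine ⟨_, ?_, reach_symm_of_mem_ball e htarget hz (hhalf hzr) hvr⟩
    obtain ⟨a, ha, ha'⟩ := hball hvr
    rw [← ha', e.left_inv ha.1]
    exact hVW ha.2
  · rintro z ⟨hz, hzr⟩ z' ⟨hz', hzr'⟩
    have := reach_symm_of_mem_ball e htarget (v := e z' - e z) hz (hhalf hzr)
      (by rw [add_sub_cancel]; exact hhalf hzr')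
    rwa [add_sub_cancel, e.left_inv hz'] at this

theorem exists_forall_reach_of_isCompact {C W : Set N} (hC : IsCompact C) (hW : W ∈ 𝓝ˢ C) :
    ∃ δ > 0, ∀ z ∈ C, ∀ v, ‖v‖ < δ → ∃ y ∈ W, Reach D z v y := by
  refine hC.induction_on (p := fun C => ∃ δ > 0, ∀ z ∈ C, ∀ v, ‖v‖ < δ → ∃ y ∈ W, Reach D z v y)
    ⟨1, one_pos, by simp⟩ ?_ ?_ fun x hx => ?_
  · rintro s t hst ⟨δ, hδ, h⟩
    exact ⟨δ, hδ, fun z hz => h z (hst hz)⟩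
  · rintro s t ⟨δ, hδ, h⟩ ⟨δ', hδ', h'⟩
    refine ⟨min δ δ', lt_min hδ hδ', fun z hz v hv => ?_⟩
    rcases hz with hz | hz
    · exact h z hz v (hv.trans_le (min_le_left _ _))
    · exact h' z hz v (hv.trans_le (min_le_right _ _))
  · obtain ⟨δ, hδ, U, hU, h, -⟩ := exists_nhds_reach hD x (mem_nhdsSet_iff_forall.1 hW x hx)
    exact ⟨U, mem_nhdsWithin_of_mem_nhds hU, δ, hδ, h⟩

variable [T2Space N]

theorem Reach.unique (h : Reach D x v y) (h' : Reach D x v z) : y = z := by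
  obtain ⟨γ, hγ, hγ0, rfl, h⟩ := h
  obtain ⟨γ', hγ', hγ0', rfl, h'⟩ := h'
  exact congrFun ((T2Space.isSeparatedMap D).eq_of_comp_eq hD.isLocallyInjective hγ hγ'
    (funext fun t => (h t).trans (h' t).symm) 0 (hγ0.trans hγ0'.symm)) 1

theorem Reach.add_smul {a b : ℝ} (ha : 0 ≤ a) (hb : 0 ≤ b) (h : Reach D x (a • v) y)
    (h' : Reach D y (b • v) z) : Reach D x ((a + b) • v) z := by
  rcases ha.eq_or_lt with rfl | ha
  · rw [zero_smul] at h
    obtain rfl := h.unique hD (Reach.zero x)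
    rwa [zero_add]
  rcases hb.eq_or_lt with rfl | hb
  · rw [zero_smul] at h'
    obtain rfl := h'.unique hD (Reach.zero y)
    rwa [add_zero]
  have hab : 0 < a + b := add_pos ha hb
  refine Reach.concat (t := a / (a + b)) (div_pos ha hab) ((div_lt_one hab).2 (by linarith))
    (y := y) ?_ ?_
  · rwa [smul_smul, div_mul_cancel₀ _ hab.ne']
  · rwa [smul_smul, sub_mul, div_mul_cancel₀ _ hab.ne', one_mul, add_sub_cancel_left]

theorem Reach.sub_smul {a b : ℝ} (ha : 0 ≤ a) (hab : a ≤ b) (h : Reach D x (a • v) y)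
    (h' : Reach D x (b • v) z) : Reach D y ((b - a) • v) z := by
  rcases (ha.trans hab).eq_or_lt with rfl | hb
  · obtain rfl := le_antisymm hab ha
    obtain rfl := h.unique hD h'
    rw [sub_self, zero_smul]
    exact Reach.zero _
  obtain ⟨y', h1, h2⟩ := h'.exists_between (t := a / b) ⟨div_nonneg ha hb.le, (div_le_one hb).2 hab⟩
  rw [smul_smul, div_mul_cancel₀ _ hb.ne'] at h1
  rw [smul_smul, sub_mul, div_mul_cancel₀ _ hb.ne', one_mul] at h2
  obtain rfl := h.unique hD h1
  exact h2

theorem exists_continuous_forall_reach {A : Type*} [TopologicalSpace A] {f : A → N} {g : A → E}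
    (hf : Continuous f) (hg : Continuous g) (h : ∀ a, Sees D (f a) (g a)) :
    ∃ p : A → N, Continuous p ∧ ∀ a, Reach D (f a) (g a) (p a) := by
  choose p β hβc hβ0 hβ1 hβ using h
  have hcont : Continuous fun a : I × A => β a.2 a.1 := by
    refine hD.continuous_lift (T2Space.isSeparatedMap D)
      ⟨fun a : I × A => D (f a.2) + (a.1 : ℝ) • g a.2, ?_⟩ (funext fun a => hβ a.2 a.1) ?_ hβc
    · have := hD.continuous
      fun_prop
    · simpa only [hβ0] using hf
  refine ⟨p, ?_, fun a => ⟨β a, hβc a, hβ0 a, hβ1 a, hβ a⟩⟩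
  simpa only [Function.comp_def, hβ1] using
    hcont.comp (by fun_prop : Continuous fun a : A => ((1 : I), a))

theorem Reach.exists_quadrilateral (hv : Reach D x v y)
    (hw : ∀ t ∈ Icc (0 : ℝ) 1, ∀ z, Reach D x (t • v) z → Sees D z (w + t • u)) :
    ∃ x' y', Reach D x w x' ∧ Reach D y (w + u) y' ∧ Reach D x' (v + u) y' := by
  obtain ⟨γ, hγ, rfl, rfl, hx, -⟩ := hv.exists_path
  obtain ⟨p, hp, hγp⟩ := exists_continuous_forall_reach hD (g := fun t : I => w + (t : ℝ) • u) hγ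
    (by fun_prop) fun t => hw t t.2 _ (hx t)
  have hp0 : Reach D (γ 0) w (p 0) := by simpa using hγp 0
  refine ⟨p 0, p 1, hp0, by simpa using hγp 1, p, hp, rfl, rfl, fun t => ?_⟩
  rw [(hγp t).apply_eq, (hx t).apply_eq, hp0.apply_eq]
  module

theorem Reach.exists_parallelogram (hv : Reach D x v y)
    (hw : ∀ t ∈ Icc (0 : ℝ) 1, ∀ z, Reach D x (t • v) z → Sees D z w) :
    ∃ x' y', Reach D x w x' ∧ Reach D y w y' ∧ Reach D x' v y' := by
  simpa using hv.exists_quadrilateral hD (w := w) (u := 0) (by simpa using hw)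

theorem Reach.exists_reach_add (hv : Reach D x v y)
    (hw : ∀ t ∈ Icc (0 : ℝ) 1, ∀ z, Reach D x (t • v) z → Sees D z w) :
    ∃ y', Reach D y w y' ∧ Reach D x (v + w) y' := by
  obtain ⟨x', y', hx', hy, hxy⟩ := hv.exists_quadrilateral hD (w := 0) (u := w)
    fun t ht z hz => by simpa using (hw t ht z hz).smul ht
  obtain rfl := hx'.unique hD (Reach.zero x)
  exact ⟨y', by simpa using hy, hxy⟩

theorem Reach.exists_triangle (hv : Reach D x v y)
    (hu : ∀ t ∈ Icc (0 : ℝ) 1, Sees D x (v + t • u)) :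
    ∃ p, Reach D y u p ∧ Reach D x (v + u) p := by
  obtain ⟨y', p, hy', hxp, hyp⟩ := (Reach.zero x).exists_quadrilateral hD (w := v) (u := u)
    fun t ht z hz => by
      rw [smul_zero] at hz
      exact (Reach.zero x).unique hD hz ▸ hu t ht
  obtain rfl := hy'.unique hD hv
  exact ⟨p, by simpa using hyp, hxp⟩

theorem Reach.exists_triangle_of_norm_le (hv : Reach D x v y)
    (h : ∀ e, ‖e‖ ≤ ‖v‖ + ‖u‖ → Sees D x e) : ∃ p, Reach D y u p ∧ Reach D x (v + u) p := by
  refine hv.exists_triangle hD fun t ht => h _ ?_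
  calc ‖v + t • u‖ ≤ ‖v‖ + ‖t • u‖ := norm_add_le _ _
    _ ≤ ‖v‖ + ‖u‖ := by
      gcongr
      rw [norm_smul, Real.norm_of_nonneg ht.1]
      exact mul_le_of_le_one_left (norm_nonneg _) ht.2

theorem sees_nsmul (h : ∀ x, Sees D x v) (n : ℕ) (x : N) : Sees D x ((n : ℝ) • v) := by
  induction n with
  | zero => simpa using (Reach.zero x).sees
  | succ n ih =>
    obtain ⟨y, hy⟩ := ih
    obtain ⟨y', -, hy'⟩ := hy.exists_reach_add hD fun _ _ z _ => h z
    rw [Nat.cast_succ, add_smul, one_smul]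
    exact hy'.sees

theorem isOpen_sees : IsOpen {a : N × E | Sees D a.1 a.2} := by
  rw [isOpen_iff_mem_nhds]
  rintro ⟨x, v⟩ ⟨y, hy⟩
  obtain ⟨γ, hγ, -, -, hxγ, -⟩ := hy.exists_path
  obtain ⟨δ, hδ, hsees⟩ :=
    exists_forall_reach_of_isCompact hD (W := univ) (isCompact_range hγ) univ_mem
  obtain ⟨-, -, U, hU, -, hreach⟩ := exists_nhds_reach hD x univ_mem
  have hcont : Continuous fun a : N × E => ‖D a.1 - D x‖ + ‖a.2 - v‖ := by
    have := hD.continuous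
    fun_prop
  have hnear : ∀ᶠ a in 𝓝 (x, v), ‖D a.1 - D x‖ + ‖a.2 - v‖ < δ :=
    hcont.continuousAt.eventually_lt continuousAt_const (by simpa using hδ)
  filter_upwards [hnear, continuousAt_fst.preimage_mem_nhds hU] with a ha haU
  obtain ⟨x', y', hx', -, h⟩ := hy.exists_quadrilateral hD (w := D a.1 - D x) (u := a.2 - v)
    fun t ht z hz => by
      obtain rfl := (hxγ ⟨t, ht⟩).unique hD hz
      obtain ⟨p, -, hp⟩ := hsees (γ ⟨t, ht⟩) (mem_range_self _) (D a.1 - D x + t • (a.2 - v)) <|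
        calc ‖D a.1 - D x + t • (a.2 - v)‖ ≤ ‖D a.1 - D x‖ + ‖t • (a.2 - v)‖ := norm_add_le _ _
          _ ≤ ‖D a.1 - D x‖ + ‖a.2 - v‖ := by
            gcongr
            rw [norm_smul, Real.norm_of_nonneg ht.1]
            exact mul_le_of_le_one_left (norm_nonneg _) ht.2
          _ < δ := ha
      exact hp.sees
  obtain rfl := hx'.unique hD (hreach x (mem_of_mem_nhds hU) a.1 haU)
  rw [add_sub_cancel] at h
  exact h.sees

theorem exists_first_not_sees {A : Type*} [TopologicalSpace A] [CompactSpace A] {f : A → N}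
    (hf : Continuous f) {a : A} (h : ¬ Sees D (f a) v) :
    ∃ τ ∈ Ioc (0 : ℝ) 1, (∃ a, ¬ Sees D (f a) (τ • v)) ∧
      ∀ t ∈ Ico (0 : ℝ) τ, ∀ a, Sees D (f a) (t • v) := by
  set S : Set ℝ := Icc 0 1 ∩ Prod.snd '' {a : A × ℝ | ¬ Sees D (f a.1) (a.2 • v)}
  have hclosed : IsClosed S := by
    refine isClosed_Icc.inter (isClosedMap_snd_of_compactSpace _ ?_)
    exact ((isOpen_sees hD).preimage (f := fun a : A × ℝ => (f a.1, a.2 • v))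
      (by fun_prop)).isClosed_compl
  have hbdd : BddBelow S := ⟨0, fun t ht => ht.1.1⟩
  obtain ⟨⟨hτ0, hτ1⟩, ⟨b, τ⟩, hb, hτ : τ = sInf S⟩ :=
    hclosed.csInf_mem ⟨1, by simp, (a, 1), by simpa using h, rfl⟩ hbdd
  rw [← hτ] at hτ0 hτ1
  refine ⟨τ, ⟨hτ0.lt_of_ne ?_, hτ1⟩, ⟨b, hb⟩, fun t ht a => ?_⟩
  · rintro rfl
    exact hb (by simpa using (Reach.zero (D := D) (f b)).sees)
  · by_contra hcon
    exact (csInf_le hbdd ⟨⟨ht.1, ht.2.le.trans hτ1⟩, (a, t), hcon, rfl⟩).not_gt (hτ ▸ ht.2)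

theorem bijective_of_forall_sees [PreconnectedSpace N] (h : ∀ v, Sees D x v) :
    Function.Bijective D := by
  obtain ⟨s, hs, hreach⟩ := exists_continuous_forall_reach hD (f := fun _ : E => x)
    (g := fun e => e - D x) continuous_const (by fun_prop) fun e => h _
  have hDs : Function.RightInverse s D := fun e => by rw [(hreach e).apply_eq, add_sub_cancel]
  have hsx : s (D x) = x := by simpa using (hreach (D x)).unique hD (by simpa using Reach.zero x)
  have hsD : s ∘ D = id := (T2Space.isSeparatedMap D).eq_of_comp_eq hD.isLocallyInjective
    (hs.comp hD.continuous) continuous_id (funext fun y => hDs (D y)) x hsx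
  exact ⟨Function.LeftInverse.injective (congrFun hsD), hDs.surjective⟩

end IsLocalHomeomorph

end Segments

/-! ### Dilations and scales -/

section Dilation

variable {ι : Type*}

/-- The diagonal map with entries `s ^ d i`, which is the action of the rank one group `A` in the
coordinates of the basis. Only `s > 0` is meaningful. -/
def dilation (d : ι → ℝ) (s : ℝ) : (ι → ℝ) →ₗ[ℝ] (ι → ℝ) where
  toFun v i := s ^ d i * v i
  map_add' v w := by ext i; simp [mul_add]
  map_smul' c v := by ext i; simp only [Pi.smul_apply, smul_eq_mul, RingHom.id_apply]; ring

@[simp]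
theorem dilation_apply (d : ι → ℝ) (s : ℝ) (v : ι → ℝ) (i : ι) :
    dilation d s v i = s ^ d i * v i := rfl

theorem dilation_mul (d : ι → ℝ) {s t : ℝ} (hs : 0 < s) (ht : 0 < t) (v : ι → ℝ) :
    dilation d (s * t) v = dilation d s (dilation d t v) := by
  ext i
  simp [Real.mul_rpow hs.le ht.le, mul_assoc]

@[simp]
theorem dilation_one (d : ι → ℝ) (v : ι → ℝ) : dilation d 1 v = v := by
  ext i
  simp

theorem dilation_inv_dilation (d : ι → ℝ) {s : ℝ} (hs : 0 < s) (v : ι → ℝ) :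
    dilation d s⁻¹ (dilation d s v) = v := by
  rw [← dilation_mul d (inv_pos.2 hs) hs, inv_mul_cancel₀ hs.ne', dilation_one]

theorem dilation_dilation_inv (d : ι → ℝ) {s : ℝ} (hs : 0 < s) (v : ι → ℝ) :
    dilation d s (dilation d s⁻¹ v) = v := by
  rw [← dilation_mul d hs (inv_pos.2 hs), mul_inv_cancel₀ hs.ne', dilation_one]

theorem dilation_injective (d : ι → ℝ) {s : ℝ} (hs : 0 < s) : Function.Injective (dilation d s) :=
  Function.LeftInverse.injective (dilation_inv_dilation d hs)

theorem dilation_neg (d : ι → ℝ) {s : ℝ} (hs : 0 < s) (v : ι → ℝ) :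
    dilation (-d) s v = dilation d s⁻¹ v := by
  ext i
  simp [Real.inv_rpow hs.le, Real.rpow_neg hs.le]

theorem dilation_single [DecidableEq ι] (d : ι → ℝ) (s c : ℝ) (i : ι) :
    dilation d s (Pi.single i c) = s ^ d i • (Pi.single i c : ι → ℝ) := by
  ext j
  by_cases hj : j = i
  · subst hj
    simp
  · simp [hj]

theorem norm_dilation_inv_lt [Fintype ι] {d v : ι → ℝ} {s δ : ℝ} (hs : 0 < s) (hδ : 0 < δ)
    (h : ∀ i, |v i| < δ * s ^ d i) : ‖dilation d s⁻¹ v‖ < δ := by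
  refine (pi_norm_lt_iff hδ).2 fun i => ?_
  have hsi : 0 < s ^ d i := Real.rpow_pos_of_pos hs _
  rw [dilation_apply, Real.inv_rpow hs.le, norm_mul, norm_inv, Real.norm_of_nonneg hsi.le,
    inv_mul_lt_iff₀ hsi, mul_comm]
  exact h i

end Dilation

theorem le_rpow_inv_abs {s a A : ℝ} (hs : 0 < s) (ha : a ≠ 0) (h : s ^ a ≤ A)
    (h' : s⁻¹ ^ a ≤ A) : s ≤ A ^ |a|⁻¹ ∧ s⁻¹ ≤ A ^ |a|⁻¹ := by
  have hA : 0 ≤ A := (Real.rpow_pos_of_pos hs a).le.trans h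
  have hs' : 0 < s⁻¹ := inv_pos.2 hs
  rw [Real.le_rpow_inv_iff_of_pos hs.le hA (abs_pos.2 ha),
    Real.le_rpow_inv_iff_of_pos hs'.le hA (abs_pos.2 ha)]
  rcases abs_choice a with habs | habs
  · rw [habs]
    exact ⟨h, h'⟩
  · rw [habs, Real.rpow_neg hs.le, ← Real.inv_rpow hs.le, Real.rpow_neg hs'.le,
      ← Real.inv_rpow hs'.le, inv_inv]
    exact ⟨h', h⟩

section RaySystem

variable {ι N : Type*} [TopologicalSpace N] {D : N → ι → ℝ} {d : ι → ℝ}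
  {K : Subgroup ((ι → ℝ) ≃ₗ[ℝ] (ι → ℝ))} {Δ : Subgroup (N ≃ₜ N)} {C : Set N} {κ : ℝ}
  {F F' : N ≃ₜ N} {s s' : ℝ} {x y : N} {v : ι → ℝ}

/-- The map `F` is developed to an affine map whose linear part is the product of an
element of `K` and of the dilation of ratio `s`. The map `D` is not required to span, so that `s`
need not be unique. -/
def HasScale (D : N → ι → ℝ) (d : ι → ℝ) (K : Subgroup ((ι → ℝ) ≃ₗ[ℝ] (ι → ℝ))) (F : N → N)
    (s : ℝ) : Prop :=
  0 < s ∧ ∃ k ∈ K, ∀ x y, D (F y) - D (F x) = k (dilation d s (D y - D x))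

/-- The data that a ray structure of rank one induces on a covering of a closed manifold, in the
coordinates of the basis: a local homeomorphism `D` that is equivariant for a properly
discontinuous group `Δ`, whose translates of `C` cover `N` and whose linear holonomy consists of
products of dilations and of elements of `K`. Of the compactness of `K` only the bound `κ` on the
operator norms is recorded. -/
structure IsRaySystem [Fintype ι] (D : N → ι → ℝ) (d : ι → ℝ)
    (K : Subgroup ((ι → ℝ) ≃ₗ[ℝ] (ι → ℝ))) (Δ : Subgroup (N ≃ₜ N)) (C : Set N) (κ : ℝ) : Prop where
  isLocalHomeomorph : IsLocalHomeomorph D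
  isCompact : IsCompact C
  cover : ∀ x, ∃ γ ∈ Δ, γ x ∈ C
  pos : 0 < κ
  bound : ∀ k ∈ K, ∀ v, ‖k v‖ ≤ κ * ‖v‖
  comm : ∀ k ∈ K, ∀ s : ℝ, 0 < s → ∀ v, k (dilation d s v) = dilation d s (k v)
  hasScale : ∀ γ ∈ Δ, ∃ s, HasScale D d K γ s
  finite : ∀ C₁ C₂ : Set N, IsCompact C₁ → IsCompact C₂ →
    {γ : N ≃ₜ N | γ ∈ Δ ∧ ∃ x ∈ C₁, γ x ∈ C₂}.Finite
  exists_ne : ∃ i, d i ≠ 0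

/-- The set `C` contains a translate of `x` by an element of `Δ` of scale `s⁻¹`, so that `x` sees
about as far in the directions of the coordinates as `dilation d s` stretches a box at `C`. -/
def AtScale (D : N → ι → ℝ) (d : ι → ℝ) (K : Subgroup ((ι → ℝ) ≃ₗ[ℝ] (ι → ℝ)))
    (Δ : Subgroup (N ≃ₜ N)) (C : Set N) (x : N) (s : ℝ) : Prop :=
  0 < s ∧ ∃ γ ∈ Δ, γ x ∈ C ∧ HasScale D d K γ s⁻¹

theorem HasScale.neg (h : HasScale D d K F s) : HasScale D (-d) K F s⁻¹ := by
  obtain ⟨hs, k, hk, h⟩ := h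
  refine ⟨inv_pos.2 hs, k, hk, fun x y => ?_⟩
  rw [h, dilation_neg d (inv_pos.2 hs), inv_inv]

namespace IsRaySystem

variable [Fintype ι]

theorem neg (R : IsRaySystem D d K Δ C κ) : IsRaySystem D (-d) K Δ C κ where
  isLocalHomeomorph := R.isLocalHomeomorph
  isCompact := R.isCompact
  cover := R.cover
  pos := R.pos
  bound := R.bound
  comm k hk s hs v := by
    rw [dilation_neg d hs, dilation_neg d hs, R.comm k hk _ (inv_pos.2 hs)]
  hasScale γ hγ := (R.hasScale γ hγ).imp' _ fun _ hs => hs.neg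
  finite := R.finite
  exists_ne := R.exists_ne.imp fun i hi => by simpa using hi

variable (R : IsRaySystem D d K Δ C κ)
include R

theorem hasScale_mul (h : HasScale D d K F s) (h' : HasScale D d K F' s') :
    HasScale D d K ⇑(F * F') (s * s') := by
  obtain ⟨hs, k, hk, h⟩ := h
  obtain ⟨hs', k', hk', h'⟩ := h'
  refine ⟨mul_pos hs hs', k * k', K.mul_mem hk hk', fun x y => ?_⟩
  change D (F (F' y)) - D (F (F' x)) = k (k' _)
  rw [h, h', dilation_mul d hs hs', R.comm k' hk' s hs]

theorem hasScale_inv (h : HasScale D d K F s) : HasScale D d K ⇑F⁻¹ s⁻¹ := by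
  obtain ⟨hs, k, hk, h⟩ := h
  refine ⟨inv_pos.2 hs, k⁻¹, K.inv_mem hk, fun x y => ?_⟩
  have hxy := h (F⁻¹ x) (F⁻¹ y)
  simp only [show ∀ x, F (F⁻¹ x) = x from F.apply_symm_apply] at hxy
  rw [hxy, ← R.comm k hk _ (inv_pos.2 hs), dilation_inv_dilation d hs]
  exact (k.symm_apply_apply _).symm

theorem norm_le {k : (ι → ℝ) ≃ₗ[ℝ] (ι → ℝ)} (hk : k ∈ K) (v : ι → ℝ) : ‖v‖ ≤ κ * ‖k v‖ := by
  simpa only [show k⁻¹ (k v) = v from k.symm_apply_apply v] using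
    R.bound k⁻¹ (K.inv_mem hk) (k v)

theorem exists_rpow_le [Nonempty N] (F : N ≃ₜ N) (i : ι) :
    ∃ A, ∀ s, HasScale D d K F s → s ^ d i ≤ A := by
  classical
  obtain ⟨x⟩ := ‹Nonempty N›
  obtain ⟨δ, hδ, U, hU, h, -⟩ := exists_nhds_reach R.isLocalHomeomorph x univ_mem
  have hv : ‖(Pi.single i (δ / 2) : ι → ℝ)‖ = δ / 2 := by
    rw [Pi.norm_single, Real.norm_of_nonneg (half_pos hδ).le]
  obtain ⟨y, -, hy⟩ := h x (mem_of_mem_nhds hU) (Pi.single i (δ / 2))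
    (by rw [hv]; exact half_lt_self hδ)
  refine ⟨κ * ‖D (F y) - D (F x)‖ / (δ / 2), fun s ⟨hs, k, hk, hF⟩ => ?_⟩
  rw [le_div_iff₀ (half_pos hδ), hF, hy.apply_eq, add_sub_cancel_left]
  calc s ^ d i * (δ / 2) = ‖dilation d s (Pi.single i (δ / 2))‖ := by
        rw [dilation_single, norm_smul, hv, Real.norm_of_nonneg (Real.rpow_nonneg hs.le _)]
    _ ≤ κ * ‖k (dilation d s (Pi.single i (δ / 2)))‖ := R.norm_le hk _

theorem exists_bound_of_hasScale [Nonempty N] (F : N ≃ₜ N) :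
    ∃ B > 0, ∀ s, HasScale D d K F s → s ≤ B ∧ s⁻¹ ≤ B := by
  obtain ⟨i, hi⟩ := R.exists_ne
  obtain ⟨A, hA⟩ := R.exists_rpow_le F i
  obtain ⟨A', hA'⟩ := R.exists_rpow_le F⁻¹ i
  refine ⟨max 1 (max A A') ^ |d i|⁻¹, by positivity, fun s hs => ?_⟩
  exact le_rpow_inv_abs hs.1 hi ((hA s hs).trans (le_max_of_le_right (le_max_left _ _)))
    ((hA' _ (R.hasScale_inv hs)).trans (le_max_of_le_right (le_max_right _ _)))

theorem exists_bound_of_finite [Nonempty N] {S : Set (N ≃ₜ N)} (hS : S.Finite) :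
    ∃ B > 0, ∀ F ∈ S, ∀ s, HasScale D d K F s → s ≤ B ∧ s⁻¹ ≤ B := by
  choose B _ h using R.exists_bound_of_hasScale
  obtain ⟨B', hB'⟩ := (hS.image B).bddAbove
  refine ⟨max 1 B', by positivity, fun F hF s hs => ?_⟩
  have hle : B F ≤ max 1 B' := (hB' (mem_image_of_mem B hF)).trans (le_max_right _ _)
  exact ⟨(h F s hs).1.trans hle, (h F s hs).2.trans hle⟩

theorem exists_atScale (x : N) : ∃ s, AtScale D d K Δ C x s := by
  obtain ⟨γ, hγ, hx⟩ := R.cover x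
  obtain ⟨s, hs⟩ := R.hasScale γ hγ
  exact ⟨s⁻¹, inv_pos.2 hs.1, γ, hγ, hx, by rwa [inv_inv]⟩

theorem exists_le_of_atScale [Nonempty N] {W : Set N} (hW : IsCompact W) :
    ∃ c > 0, ∀ x ∈ W, ∀ s, AtScale D d K Δ C x s → c ≤ s := by
  obtain ⟨B, hB, hbound⟩ := R.exists_bound_of_finite (R.finite W C hW R.isCompact)
  refine ⟨B⁻¹, inv_pos.2 hB, fun x hx s ⟨hs, γ, hγ, hγx, hγs⟩ => ?_⟩
  exact inv_le_of_inv_le₀ hs (hbound γ ⟨hγ, x, hx, hγx⟩ _ hγs).1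

theorem exists_reach_of_hasScale (h : HasScale D d K F s) {δ : ℝ} {W : Set N}
    (hsees : ∀ u, ‖u‖ < δ → ∃ y ∈ W, Reach D (F x) u y) (hv : ‖dilation d s v‖ < δ / κ) :
    ∃ y, F y ∈ W ∧ Reach D x v y := by
  obtain ⟨hs, k, hk, hF⟩ := h
  have hnorm : ‖k (dilation d s v)‖ < δ := calc
    _ ≤ κ * ‖dilation d s v‖ := R.bound k hk _
    _ < κ * (δ / κ) := mul_lt_mul_of_pos_left hv R.pos
    _ = δ := mul_div_cancel₀ _ R.pos.ne'
  obtain ⟨y, hy, hxy⟩ := hsees _ hnorm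
  have hinj : Function.Injective (k.toLinearMap ∘ₗ dilation d s) :=
    k.injective.comp (dilation_injective d hs)
  exact ⟨F.symm y, by rwa [F.apply_symm_apply], Reach.of_map hinj hF hxy⟩

-- Move the point to `C`, where all points see a ball of fixed radius within a compact set.
theorem exists_box [Nonempty N] [LocallyCompactSpace N] :
    ∃ δ > 0, ∃ B > 0, ∀ x s, AtScale D d K Δ C x s → ∀ v : ι → ℝ, (∀ i, |v i| < δ * s ^ d i) →
      ∃ y, Reach D x v y ∧ ∀ s', AtScale D d K Δ C y s' → s' ≤ B * s := by
  obtain ⟨C', hC', hCC'⟩ := exists_compact_superset R.isCompact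
  obtain ⟨δ, hδ, hsees⟩ := exists_forall_reach_of_isCompact R.isLocalHomeomorph R.isCompact
    (subset_interior_iff_mem_nhdsSet.1 hCC')
  obtain ⟨B, hB, hbound⟩ := R.exists_bound_of_finite (R.finite C' C hC' R.isCompact)
  refine ⟨δ / κ, div_pos hδ R.pos, B, hB, fun x s hx v hv => ?_⟩
  obtain ⟨hs, γ, hγ, hxC, hγs⟩ := hx
  obtain ⟨y, hy, hxy⟩ := R.exists_reach_of_hasScale hγs (hsees (γ x) hxC)
    (norm_dilation_inv_lt hs (div_pos hδ R.pos) hv)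
  refine ⟨y, hxy, fun s' ⟨_, γ', hγ', hyC, hγs'⟩ => ?_⟩
  have hle := (hbound (γ' * γ⁻¹) ⟨Δ.mul_mem hγ' (Δ.inv_mem hγ), γ y, hy,
    by simpa [show ∀ z, γ⁻¹ (γ z) = z from γ.symm_apply_apply] using hyC⟩ _
    (R.hasScale_mul hγs' (R.hasScale_inv hγs))).2
  rwa [mul_inv, inv_inv, inv_inv, ← div_eq_mul_inv, div_le_iff₀ hs] at hle

end IsRaySystem

end RaySystem

/-! ### Visibility from a point and scales -/

section Visibility

variable {ι N : Type*} [TopologicalSpace N] {D : N → ι → ℝ} {d : ι → ℝ}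
  {K : Subgroup ((ι → ℝ) ≃ₗ[ℝ] (ι → ℝ))} {Δ : Subgroup (N ≃ₜ N)} {C : Set N} {κ : ℝ}
  {x y z p q : N} {u v w : ι → ℝ}

/-- The vector `v` is in the span of the directions of positive exponent, which large dilations
expand. Those contracted by large dilations are the vectors with `IsExpanded (-d) v`. -/
def IsExpanded (d v : ι → ℝ) : Prop := ∀ i, d i ≤ 0 → v i = 0

/-- The vector `w` is in the span of the directions of non-positive exponent, which is
complementary to the expanded directions. -/
def IsTransverse (d w : ι → ℝ) : Prop := ∀ i, 0 < d i → w i = 0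

/-- Every map with a scale that takes some point of `C` to a point of `C` has its scale in
`[r⁻¹, r]`. -/
def HasScaleBound (D : N → ι → ℝ) (d : ι → ℝ) (K : Subgroup ((ι → ℝ) ≃ₗ[ℝ] (ι → ℝ))) (C : Set N)
    (r : ℝ) : Prop :=
  ∀ (F : N ≃ₜ N) (s : ℝ), HasScale D d K F s → ∀ z ∈ C, F z ∈ C → s ≤ r ∧ s⁻¹ ≤ r

/-- The point `x` sees all expanded directions. -/
def SeesExpanded [Fintype ι] (D : N → ι → ℝ) (d : ι → ℝ) (x : N) : Prop :=
  ∀ v, IsExpanded d v → Sees D x v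

theorem IsExpanded.smul (h : IsExpanded d v) (c : ℝ) : IsExpanded d (c • v) := fun i hi => by
  simp [h i hi]

theorem IsExpanded.isTransverse (h : IsExpanded (-d) w) : IsTransverse d w :=
  fun i hi => h i (by simpa using hi.le)

theorem IsExpanded.eq_zero_of_exponent_eq_zero (h : IsExpanded d v) {i : ι} (hi : d i = 0) :
    v i = 0 := h i hi.le

theorem norm_indicator_le [Fintype ι] (S : Set ι) (v : ι → ℝ) : ‖S.indicator v‖ ≤ ‖v‖ :=
  (pi_norm_le_iff_of_nonneg (norm_nonneg _)).2 fun i =>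
    (norm_indicator_le_norm_self v i).trans (norm_le_pi_norm v i)

theorem exists_eq_add_expanded [Fintype ι] (d v : ι → ℝ) : ∃ v₁ v₂, v = v₁ + v₂ ∧
    IsExpanded d v₁ ∧ IsTransverse d v₂ ∧ ‖v₁‖ ≤ ‖v‖ ∧ ‖v₂‖ ≤ ‖v‖ := by
  let S : Set ι := {i | 0 < d i}
  exact ⟨S.indicator v, Sᶜ.indicator v, (S.indicator_self_add_compl v).symm,
    fun i hi => indicator_of_notMem (s := S) (not_lt.2 hi) v,
    fun i hi => indicator_of_notMem (s := Sᶜ) (not_not.2 hi) v,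
    norm_indicator_le S v, norm_indicator_le Sᶜ v⟩

theorem IsTransverse.exists_eq_add (hw : IsTransverse d w) : ∃ w₁ w₂, w = w₁ + w₂ ∧
    IsExpanded (-d) w₁ ∧ ∀ i, d i ≠ 0 → w₂ i = 0 := by
  let S : Set ι := {i | d i < 0}
  refine ⟨S.indicator w, Sᶜ.indicator w, (S.indicator_self_add_compl w).symm,
    fun i hi => indicator_of_notMem (by simpa [S] using hi) w, fun i hi => ?_⟩
  rcases hi.lt_or_gt with hi | hi
  · exact indicator_of_notMem (not_not.2 hi) w
  · exact indicator_apply_eq_zero.2 fun _ => hw i hi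

theorem eventually_lt_mul_rpow_of_isTransverse [Finite ι] {δ : ℝ} (hδ : 0 < δ)
    (hw : IsTransverse d w) (hw0 : ∀ i, d i = 0 → |w i| < δ) :
    ∀ᶠ s in 𝓝[>] (0 : ℝ), ∀ i, |w i| < δ * s ^ d i := by
  rw [eventually_all]
  intro i
  rcases lt_trichotomy (d i) 0 with hi | hi | hi
  · exact ((tendsto_rpow_neg_nhdsGT_zero hi).const_mul_atTop hδ).eventually_gt_atTop _
  · simpa [hi] using hw0 i hi
  · filter_upwards [self_mem_nhdsWithin] with s hs
    rw [hw i hi, abs_zero]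
    exact mul_pos hδ (Real.rpow_pos_of_pos hs _)

theorem eventually_forall_lt_mul_rpow [Finite ι] {ρ : ℝ} (hρ : 0 < ρ) (a : ℝ) :
    ∀ᶠ s in atTop, ∀ i, 0 < d i → a < ρ * s ^ d i := by
  rw [eventually_all]
  intro i
  by_cases hi : 0 < d i
  · filter_upwards [((tendsto_rpow_atTop hi).const_mul_atTop hρ).eventually_gt_atTop a] with s hs _
    exact hs
  · exact Eventually.of_forall fun s h => absurd h hi

theorem IsExpanded.forall_abs_lt {ρ s : ℝ} (hv : IsExpanded d v) (hρ : 0 < ρ) (hs : 0 < s)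
    (h : ∀ i, 0 < d i → |v i| < ρ * s ^ d i) (i : ι) : |v i| < ρ * s ^ d i := by
  rcases le_or_gt (d i) 0 with hi | hi
  · rw [hv i hi, abs_zero]
    exact mul_pos hρ (Real.rpow_pos_of_pos hs _)
  · exact h i hi

namespace IsRaySystem

variable [Fintype ι] (R : IsRaySystem D d K Δ C κ)
include R

theorem seesExpanded_of_reach [T2Space N] (hv : IsExpanded d v) (h : Reach D x v y)
    (hy : SeesExpanded D d y) : SeesExpanded D d x := fun u hu => by
  obtain ⟨p, hp, -⟩ := h.symm.exists_triangle R.isLocalHomeomorph (u := u) fun t _ =>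
    hy _ fun i hi => by simp [hv i hi, hu i hi]
  exact hp.sees

theorem exists_first_expanded [T2Space N] (h : ¬ SeesExpanded D d x) :
    ∃ v, IsExpanded d v ∧ (∀ t ∈ Ico (0 : ℝ) 1, Sees D x (t • v)) ∧ ¬ Sees D x v := by
  simp only [SeesExpanded, not_forall] at h
  obtain ⟨v, hv, h⟩ := h
  obtain ⟨τ, hτ, ⟨-, hτv⟩, hlt⟩ := exists_first_not_sees R.isLocalHomeomorph
    (f := fun _ : Unit => x) continuous_const (a := ()) h
  refine ⟨τ • v, hv.smul τ, fun t ht => ?_, hτv⟩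
  rw [smul_smul]
  exact hlt _ ⟨mul_nonneg ht.1 hτ.1.le, mul_lt_of_lt_one_left hτ.1 ht.2⟩ ()

variable [Nonempty N] [LocallyCompactSpace N]

theorem eventually_atScale_lt (hv : IsExpanded d v) (hx : ¬ Sees D x v) {η : ℝ} (hη : 0 < η) :
    ∀ᶠ t in 𝓝[<] (1 : ℝ), ∀ z, Reach D x (t • v) z → ∀ s, AtScale D d K Δ C z s → s < η := by
  obtain ⟨δ, hδ, _, -, hbox⟩ := R.exists_box
  have hsmall : ∀ᶠ t in 𝓝[<] (1 : ℝ), ∀ i, (1 - t) * |v i| < δ * η ^ d i := by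
    rw [eventually_all]
    intro i
    have hcont : ContinuousAt (fun t : ℝ => (1 - t) * |v i|) 1 := by fun_prop
    exact (hcont.eventually_lt continuousAt_const
      (by simpa using mul_pos hδ (Real.rpow_pos_of_pos hη (d i)))).filter_mono nhdsWithin_le_nhds
  filter_upwards [hsmall, Ioo_mem_nhdsLT zero_lt_one] with t ht ⟨ht0, ht1⟩ z hz s hs
  by_contra! hηs
  obtain ⟨y, hy, -⟩ := hbox z s hs ((1 - t) • v)
    ((hv.smul _).forall_abs_lt hδ hs.1 fun i hi => by
      rw [Pi.smul_apply, smul_eq_mul, abs_mul, abs_of_pos (sub_pos.2 ht1)]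
      exact (ht i).trans_le (by gcongr))
  exact hx ⟨y, Reach.concat ht0 ht1 hz hy⟩

variable [T2Space N]

-- If `q` saw `u`, the lift of the segment from `q` would end in a compact neighbourhood, where
-- scales are bounded below; but the scales tend to zero along the parallel segment from `z`, and
-- they grow by a bounded factor between the two segments.
theorem not_sees_of_scale_le {B : ℝ} (hB : 0 < B) (hu : IsExpanded d u) (hzu : ¬ Sees D z u)
    (hz : ∀ t ∈ Ico (0 : ℝ) 1, Sees D z (t • u))
    (hw : ∀ t ∈ Ico (0 : ℝ) 1, ∀ m, Reach D z (t • u) m → ∀ s, AtScale D d K Δ C m s →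
      ∃ p, Reach D m w p ∧ ∀ s', AtScale D d K Δ C p s' → s' ≤ B * s)
    (hq : Reach D z w q) : ¬ Sees D q u := by
  have hD := R.isLocalHomeomorph
  rintro ⟨e, he⟩
  obtain ⟨β, hβ, -, rfl, hqβ, -⟩ := he.exists_path
  obtain ⟨W, hW, hβW⟩ := exists_compact_mem_nhds (β 1)
  obtain ⟨c, hc, hcW⟩ := R.exists_le_of_atScale hW
  have hβW' : ∀ᶠ t in 𝓝[<] (1 : ℝ), β (projIcc 0 1 zero_le_one t) ∈ W := by
    have hcont : Continuous fun t : ℝ => β (projIcc 0 1 zero_le_one t) := hβ.comp (by fun_prop)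
    exact nhdsWithin_le_nhds (hcont.continuousAt.preimage_mem_nhds (by simpa using hβW))
  obtain ⟨t, ⟨htW, hts⟩, ht0, ht1⟩ :=
    ((hβW'.and (R.eventually_atScale_lt hu hzu (div_pos hc hB))).and
      (Ioo_mem_nhdsLT zero_lt_one)).exists
  obtain ⟨m, hm⟩ := hz t ⟨ht0.le, ht1⟩
  obtain ⟨q', p, hq', hp, hqp⟩ := hm.exists_parallelogram hD (w := w) fun r hr m' hm' => by
    obtain ⟨s, hs⟩ := R.exists_atScale m'
    rw [smul_smul] at hm'
    obtain ⟨p, hp, -⟩ := hw _ ⟨mul_nonneg hr.1 ht0.le,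
      (mul_le_of_le_one_left ht0.le hr.2).trans_lt ht1⟩ m' hm' s hs
    exact hp.sees
  obtain rfl := hq.unique hD hq'
  have ht : t ∈ Icc (0 : ℝ) 1 := ⟨ht0.le, ht1.le⟩
  rw [projIcc_of_mem _ ht, (hqβ ⟨t, ht⟩).unique hD hqp] at htW
  obtain ⟨s, hs⟩ := R.exists_atScale m
  obtain ⟨s', hs'⟩ := R.exists_atScale p
  obtain ⟨p', hp', hle⟩ := hw t ⟨ht0.le, ht1⟩ m hm s hs
  obtain rfl := hp.unique hD hp'
  have hsc := hts m hm s hs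
  rw [lt_div_iff₀ hB] at hsc
  linarith [hcW p htW s' hs', hle s' hs']

theorem exists_obstruction : ∃ δ > 0, ∀ x v, IsExpanded d v →
    (∀ t ∈ Ico (0 : ℝ) 1, Sees D x (t • v)) → ¬ Sees D x v → ∀ w, IsTransverse d w →
    (∀ i, d i = 0 → |w i| < δ) → ∀ᶠ t in 𝓝[<] (1 : ℝ), ∀ z, Reach D x (t • v) z →
      ∃ q, Reach D z w q ∧ ¬ Sees D q ((1 - t) • v) := by
  have hD := R.isLocalHomeomorph
  obtain ⟨δ, hδ, B, hB, hbox⟩ := R.exists_box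
  refine ⟨δ, hδ, fun x v hv hsee hxv w hw hw0 => ?_⟩
  obtain ⟨η, hη, hηw⟩ := mem_nhdsGT_iff_exists_Ioo_subset.1
    (eventually_lt_mul_rpow_of_isTransverse hδ hw hw0)
  obtain ⟨l, hl, hls⟩ := (mem_nhdsLT_iff_exists_Ioo_subset' (zero_lt_one' ℝ)).1
    (R.eventually_atScale_lt hv hxv hη)
  filter_upwards [Ioo_mem_nhdsLT hl, Ioo_mem_nhdsLT zero_lt_one] with t ⟨htl, ht1⟩ ⟨ht0, _⟩ z hz
  have h1t : 0 < 1 - t := sub_pos.2 ht1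
  have hlt : ∀ r ∈ Ico (0 : ℝ) 1, t + r * (1 - t) < 1 := fun r hr => by nlinarith [hr.2]
  have hle : ∀ r ∈ Ico (0 : ℝ) 1, t ≤ t + r * (1 - t) := fun r hr => by nlinarith [hr.1]
  have hwbox : ∀ r ∈ Ico (0 : ℝ) 1, ∀ m, Reach D z (r • (1 - t) • v) m →
      ∀ s, AtScale D d K Δ C m s →
      ∃ p, Reach D m w p ∧ ∀ s', AtScale D d K Δ C p s' → s' ≤ B * s := fun r hr m hm s hs => by
    rw [smul_smul] at hm
    have hxm := hz.add_smul hD ht0.le (mul_nonneg hr.1 h1t.le) hm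
    exact hbox m s hs w (hηw ⟨hs.1, hls ⟨htl.trans_le (hle r hr), hlt r hr⟩ m hxm s hs⟩)
  have hzsee : ∀ r ∈ Ico (0 : ℝ) 1, Sees D z (r • (1 - t) • v) := fun r hr => by
    obtain ⟨m, hm⟩ := hsee _ ⟨ht0.le.trans (hle r hr), hlt r hr⟩
    rw [smul_smul, ← add_sub_cancel_left t (r * (1 - t))]
    exact (hz.sub_smul hD ht0.le (hle r hr) hm).sees
  have hznot : ¬ Sees D z ((1 - t) • v) := fun ⟨e, he⟩ => hxv ⟨e, Reach.concat ht0 ht1 hz he⟩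
  obtain ⟨s, hs⟩ := R.exists_atScale z
  obtain ⟨q, hq, -⟩ := hwbox 0 (by simp) z (by simpa using Reach.zero z) s hs
  exact ⟨q, hq, R.not_sees_of_scale_le hB (hv.smul _) hznot hzsee hwbox hq⟩

theorem sees_of_reach_of_forall_sees (hw : IsExpanded d w) (hv : IsExpanded (-d) v)
    (hxy : Reach D x v y) (hyw : Sees D y w)
    (h : ∀ t ∈ Ico (0 : ℝ) 1, ∀ a ∈ Icc (0 : ℝ) 1, ∀ z, Reach D x (a • v) z → Sees D z (t • w)) :
    Sees D x w := by
  have hD := R.isLocalHomeomorph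
  by_contra hxw
  obtain ⟨δ, hδ, hobs⟩ := R.exists_obstruction
  have hobsx := hobs x w hw (fun t ht => h t ht 0 (by simp) x (by simpa using Reach.zero x)) hxw v
    hv.isTransverse fun i hi => by
      rwa [hv.eq_zero_of_exponent_eq_zero (by simpa using hi), abs_zero]
  obtain ⟨t, ht, ht0, ht1⟩ := (hobsx.and (Ioo_mem_nhdsLT zero_lt_one)).exists
  obtain ⟨z, p, hz, hyp, hzp⟩ := hxy.exists_parallelogram hD (h t ⟨ht0.le, ht1⟩)
  obtain ⟨q, hq, hnot⟩ := ht z hz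
  obtain rfl := hzp.unique hD hq
  obtain ⟨e, he⟩ := hyw
  obtain ⟨p', hyp', hpe⟩ := he.exists_between ⟨ht0.le, ht1.le⟩
  obtain rfl := hyp.unique hD hyp'
  exact hnot hpe.sees

theorem sees_of_reach_contracted (hw : IsExpanded d w) (hv : IsExpanded (-d) v)
    (hxy : Reach D x v y) (hyw : Sees D y w) : Sees D x w := by
  have hD := R.isLocalHomeomorph
  by_contra hxw
  obtain ⟨γ, hγ, rfl, rfl, -, hγγ⟩ := hxy.exists_path
  obtain ⟨τ, ⟨hτ0, hτ1⟩, ⟨r, hr⟩, hlt⟩ := exists_first_not_sees hD hγ hxw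
  refine hr (R.sees_of_reach_of_forall_sees (hw.smul τ) (hv.smul _) (hγγ r 1)
    (hyw.smul ⟨hτ0.le, hτ1⟩) fun t ht a ha z hz => ?_)
  have hmem : (r : ℝ) + a * (1 - r) ∈ unitInterval := by
    constructor <;> nlinarith [r.2.1, r.2.2, ha.1, ha.2]
  have hreach := hγγ r ⟨_, hmem⟩
  rw [add_sub_cancel_left, mul_smul] at hreach
  rw [hz.unique hD hreach, smul_smul]
  exact hlt _ ⟨mul_nonneg ht.1 hτ0.le, mul_lt_of_lt_one_left hτ0 ht.2⟩ _

theorem seesExpanded_neg (h : ¬ SeesExpanded D d x) : SeesExpanded D (-d) x := by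
  intro w hw
  obtain ⟨v, hv, hsee, hnot⟩ := R.exists_first_expanded h
  obtain ⟨δ, hδ, hobs⟩ := R.exists_obstruction
  have hobsx := hobs x v hv hsee hnot w hw.isTransverse fun i hi => by
    rwa [hw.eq_zero_of_exponent_eq_zero (by simpa using hi), abs_zero]
  obtain ⟨t, ht, ht0, ht1⟩ := (hobsx.and (Ioo_mem_nhdsLT zero_lt_one)).exists
  obtain ⟨z, hz⟩ := hsee t ⟨ht0.le, ht1⟩
  obtain ⟨q, hq, -⟩ := ht z hz
  exact R.neg.sees_of_reach_contracted hw (by simpa using hv.smul t) hz hq.sees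

theorem sees_of_exponent_zero (hw : ∀ i, d i ≠ 0 → w i = 0) (x : N) : Sees D x w := by
  obtain ⟨δ, hδ, _, -, hbox⟩ := R.exists_box
  obtain ⟨n, hn⟩ := exists_nat_gt (‖w‖ / δ)
  have hn0 : (0 : ℝ) < n := (div_nonneg (norm_nonneg _) hδ.le).trans_lt hn
  have hsmall : ∀ x, Sees D x ((n : ℝ)⁻¹ • w) := fun x => by
    obtain ⟨s, hs⟩ := R.exists_atScale x
    obtain ⟨y, hy, -⟩ := hbox x s hs ((n : ℝ)⁻¹ • w) fun i => by
      by_cases hi : d i = 0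
      · rw [hi, Real.rpow_zero, mul_one, Pi.smul_apply, smul_eq_mul, abs_mul, abs_inv,
          Nat.abs_cast, inv_mul_lt_iff₀ hn0]
        rw [div_lt_iff₀ hδ] at hn
        exact (norm_le_pi_norm w i).trans_lt hn
      · rw [Pi.smul_apply, hw i hi, smul_zero, abs_zero]
        exact mul_pos hδ (Real.rpow_pos_of_pos hs.1 _)
    exact hy.sees
  simpa [smul_smul, hn0.ne'] using sees_nsmul R.isLocalHomeomorph hsmall n x

theorem sees_of_seesExpanded_neg (h : SeesExpanded D (-d) x) (hw : IsTransverse d w) :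
    Sees D x w := by
  obtain ⟨w₁, w₂, rfl, h₁, h₂⟩ := hw.exists_eq_add
  obtain ⟨y, hy⟩ := h w₁ h₁
  obtain ⟨p, -, hp⟩ := hy.exists_reach_add R.isLocalHomeomorph (w := w₂)
    fun _ _ z _ => R.sees_of_exponent_zero h₂ z
  exact hp.sees

theorem sees_of_transverse (h : ¬ SeesExpanded D d x) (hw : IsTransverse d w) : Sees D x w :=
  R.sees_of_seesExpanded_neg (R.seesExpanded_neg h) hw

theorem sees_of_forall_seesExpanded (h : ∀ x, SeesExpanded D d x)
    (h' : ∀ x, SeesExpanded D (-d) x) (x : N) (v : ι → ℝ) : Sees D x v := by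
  obtain ⟨v₁, v₂, rfl, hv₁, hv₂, -⟩ := exists_eq_add_expanded d v
  obtain ⟨y, hy⟩ := h x v₁ hv₁
  obtain ⟨p, -, hp⟩ := hy.exists_reach_add R.isLocalHomeomorph (w := v₂)
    fun _ _ z _ => R.sees_of_seesExpanded_neg (h' z) hv₂
  exact hp.sees

theorem sees_add_of_transverse (h : ¬ SeesExpanded D d x) (hv : IsExpanded d v)
    (hxv : Sees D x v) (hw : IsTransverse d w) : Sees D x (v + w) := by
  obtain ⟨y, hy⟩ := hxv
  obtain ⟨p, -, hp⟩ := hy.exists_reach_add R.isLocalHomeomorph (w := w)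
    fun t _ z hz => R.sees_of_transverse
      (fun hz' => h (R.seesExpanded_of_reach (hv.smul t) hz hz')) hw
  exact hp.sees

theorem exists_seesExpanded_of_reach_transverse : ∃ δ > 0, ∀ y z w, IsTransverse d w → ‖w‖ < δ →
    Reach D y w z → SeesExpanded D d z → SeesExpanded D d y := by
  have hD := R.isLocalHomeomorph
  obtain ⟨δ, hδ, hobs⟩ := R.exists_obstruction
  refine ⟨δ, hδ, fun y z w hw hwδ hyz hsee => ?_⟩
  by_contra hy
  obtain ⟨v, hv, hyv, hynot⟩ := R.exists_first_expanded hy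
  obtain ⟨t, ht, ht0, ht1⟩ := ((hobs y v hv hyv hynot w hw fun i _ =>
    (norm_le_pi_norm w i).trans_lt hwδ).and (Ioo_mem_nhdsLT zero_lt_one)).exists
  obtain ⟨m, hm⟩ := hyv t ⟨ht0.le, ht1⟩
  obtain ⟨q, hq, hqnot⟩ := ht m hm
  obtain ⟨z', q', hyz', hq', hzq⟩ := hm.exists_parallelogram hD (w := w) fun r _ a ha =>
    R.sees_of_transverse (fun h => hy (R.seesExpanded_of_reach ((hv.smul t).smul r) ha h)) hw
  obtain rfl := hyz.unique hD hyz'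
  obtain rfl := hq.unique hD hq'
  obtain ⟨e, he⟩ := hsee v hv
  obtain ⟨q', hzq', hqe⟩ := he.exists_between ⟨ht0.le, ht1.le⟩
  obtain rfl := hzq.unique hD hzq'
  exact hqnot hqe.sees

theorem exists_nhds_seesExpanded (x : N) :
    ∃ U ∈ 𝓝 x, ∀ z ∈ U, ∀ z' ∈ U, SeesExpanded D d z' → SeesExpanded D d z := by
  have hD := R.isLocalHomeomorph
  obtain ⟨δ₁, hδ₁, htrans⟩ := R.exists_seesExpanded_of_reach_transverse
  obtain ⟨δ₂, hδ₂, U, hU, hsees, hreach⟩ := exists_nhds_reach hD x univ_mem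
  have hδ : 0 < min δ₁ δ₂ / 4 := by positivity
  refine ⟨U ∩ D ⁻¹' Metric.ball (D x) (min δ₁ δ₂ / 4), inter_mem hU
    (hD.continuous.continuousAt.preimage_mem_nhds (Metric.ball_mem_nhds _ hδ)), ?_⟩
  rintro z ⟨hz, hzδ⟩ z' ⟨hz', hzδ'⟩ hsee
  have hnorm : ‖D z' - D z‖ < min δ₁ δ₂ / 2 := by
    rw [← dist_eq_norm]
    rw [mem_preimage, Metric.mem_ball] at hzδ hzδ'
    linarith [dist_triangle_right (D z') (D z) (D x)]
  obtain ⟨v, w, hvw, hv, hw, hvn, hwn⟩ := exists_eq_add_expanded d (D z' - D z)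
  obtain ⟨y, -, hy⟩ := hsees z hz v (by linarith [min_le_right δ₁ δ₂])
  obtain ⟨p, hyp, hzp⟩ := hy.exists_triangle_of_norm_le hD (u := w) fun e he => by
    obtain ⟨q, -, hq⟩ := hsees z hz e (by linarith [min_le_right δ₁ δ₂])
    exact hq.sees
  rw [← hvw] at hzp
  obtain rfl := (hreach z hz z' hz').unique hD hzp
  exact R.seesExpanded_of_reach hv hy
    (htrans y _ w hw (by linarith [min_le_left δ₁ δ₂]) hyp hsee)

theorem forall_seesExpanded_or_forall_not [PreconnectedSpace N] :
    (∀ x, SeesExpanded D d x) ∨ ∀ x, ¬ SeesExpanded D d x := by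
  have hconst : IsLocallyConstant (SeesExpanded D d) := by
    refine (IsLocallyConstant.iff_eventually_eq _).2 fun x => ?_
    obtain ⟨U, hU, h⟩ := R.exists_nhds_seesExpanded x
    filter_upwards [hU] with z hz
    have hx := mem_of_mem_nhds hU
    exact propext ⟨h x hx z hz, h z hz x hx⟩
  by_cases h : ∃ x, SeesExpanded D d x
  · obtain ⟨x, hx⟩ := h
    exact .inl fun z => hconst.apply_eq_of_preconnectedSpace x z ▸ hx
  · exact .inr (not_exists.1 h)

theorem sees_of_norm_le (h : ∀ x, ¬ SeesExpanded D d x) {a : ℝ}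
    (hx : ∀ v, IsExpanded d v → ‖v‖ ≤ a → Sees D x v) (hv : ‖v‖ ≤ a) : Sees D x v := by
  obtain ⟨v₁, v₂, rfl, hv₁, hv₂, hn, -⟩ := exists_eq_add_expanded d v
  exact R.sees_add_of_transverse (h x) hv₁ (hx v₁ hv₁ (hn.trans hv)) hv₂

theorem exists_not_sees_norm_le (h : ∀ x, ¬ SeesExpanded D d x) (hinc : ∀ x, ∃ v, ¬ Sees D x v) :
    ∃ a, ∀ y ∈ C, ∃ v, IsExpanded d v ∧ ‖v‖ ≤ a ∧ ¬ Sees D y v := by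
  have hD := R.isLocalHomeomorph
  refine R.isCompact.induction_on
    (p := fun C => ∃ a, ∀ y ∈ C, ∃ v, IsExpanded d v ∧ ‖v‖ ≤ a ∧ ¬ Sees D y v)
    ⟨0, by simp⟩ (fun s t hst ⟨a, ha⟩ => ⟨a, fun y hy => ha y (hst hy)⟩) ?_ fun x _ => ?_
  · rintro s t ⟨a, ha⟩ ⟨b, hb⟩
    refine ⟨max a b, fun y hy => ?_⟩
    rcases hy with hy | hy
    · obtain ⟨v, hv, hle, hnot⟩ := ha y hy
      exact ⟨v, hv, le_max_of_le_left hle, hnot⟩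
    · obtain ⟨v, hv, hle, hnot⟩ := hb y hy
      exact ⟨v, hv, le_max_of_le_right hle, hnot⟩
  obtain ⟨v, hv⟩ := hinc x
  obtain ⟨-, -, U, hU, -, hreach⟩ := exists_nhds_reach hD x univ_mem
  have hball : D ⁻¹' Metric.closedBall (D x) 1 ∈ 𝓝 x :=
    hD.continuous.continuousAt.preimage_mem_nhds (Metric.closedBall_mem_nhds _ one_pos)
  refine ⟨_, mem_nhdsWithin_of_mem_nhds (inter_mem hU hball), 1 + ‖v‖, fun y ⟨hyU, hyx⟩ => ?_⟩
  by_contra! hy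
  obtain ⟨p, hp, -⟩ := (hreach y hyU x (mem_of_mem_nhds hU)).exists_triangle_of_norm_le hD
    (u := v) fun e he => R.sees_of_norm_le h hy <| he.trans <| by
      gcongr
      rw [← dist_eq_norm, dist_comm]
      exact hyx
  exact hv hp.sees

theorem exists_hasScaleBound (h : ∀ x, ¬ SeesExpanded D d x) (hinc : ∀ x, ∃ v, ¬ Sees D x v) :
    ∃ r, HasScaleBound D d K C r := by
  obtain ⟨δ, hδ, hC⟩ := exists_forall_reach_of_isCompact R.isLocalHomeomorph R.isCompact
    (W := univ) univ_mem
  obtain ⟨a, ha⟩ := R.exists_not_sees_norm_le h hinc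
  have hδκ := div_pos hδ R.pos
  obtain ⟨r, hr⟩ := eventually_atTop.1 (eventually_forall_lt_mul_rpow (d := d) hδκ a)
  have key : ∀ F : N ≃ₜ N, ∀ s, HasScale D d K F s → ∀ z ∈ C, F z ∈ C → s ≤ max r 1 := by
    intro F s hF z hz hFz
    by_contra! hs
    obtain ⟨v, hv, hva, hnot⟩ := ha _ hFz
    have hvs : ‖dilation d s⁻¹ v‖ < δ / κ := norm_dilation_inv_lt hF.1 hδκ <|
      hv.forall_abs_lt hδκ hF.1 fun i hi => ((norm_le_pi_norm v i).trans hva).trans_lt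
        (hr s ((le_max_left _ _).trans hs.le) i hi)
    obtain ⟨y, -, hy⟩ := R.exists_reach_of_hasScale (x := F z) (R.hasScale_inv hF)
      (fun u hu => by simpa only [show F⁻¹ (F z) = z from F.symm_apply_apply z] using hC z hz u hu)
      hvs
    exact hnot hy.sees
  refine ⟨max r 1, fun F s hs z hz hFz => ⟨key F s hs z hz hFz,
    key F⁻¹ s⁻¹ (R.hasScale_inv hs) (F z) hFz ?_⟩⟩
  rwa [show F⁻¹ (F z) = z from F.symm_apply_apply z]

theorem forall_sees_or_exists_hasScaleBound [PreconnectedSpace N] :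
    (∃ x, ∀ v, Sees D x v) ∨ ∃ r, HasScaleBound D d K C r := by
  by_cases hinc : ∃ x, ∀ v, Sees D x v
  · exact Or.inl hinc
  push Not at hinc
  refine Or.inr ?_
  rcases R.forall_seesExpanded_or_forall_not with h | h
  · rcases R.neg.forall_seesExpanded_or_forall_not with h' | h'
    · obtain ⟨x⟩ := ‹Nonempty N›
      obtain ⟨v, hv⟩ := hinc x
      exact absurd (R.sees_of_forall_seesExpanded h h' x v) hv
    · obtain ⟨r, hbound⟩ := R.neg.exists_hasScaleBound h' hinc
      refine ⟨r, fun F s hs z hz hFz => ?_⟩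
      simpa only [inv_inv] using (hbound F s⁻¹ hs.neg z hz hFz).symm
  · exact R.exists_hasScaleBound h hinc

end IsRaySystem

end Visibility

/-! ### Limits of maps with bounded scales -/

section Limits

theorem exists_norm_dilation_le {ι : Type*} [Fintype ι] (d : ι → ℝ) (r : ℝ) :
    ∃ Λ > 0, ∀ s : ℝ, 0 < s → s ≤ r → s⁻¹ ≤ r → ∀ v, ‖dilation d s v‖ ≤ Λ * ‖v‖ := by
  rcases le_or_gt r 0 with hr | hr
  · exact ⟨1, one_pos, fun s hs hs' => absurd hs (hs'.trans hr).not_gt⟩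
  refine ⟨1 + ∑ i, r ^ |d i|, by positivity, fun s hs hsr hsr' v => ?_⟩
  refine (pi_norm_le_iff_of_nonneg (by positivity)).2 fun i => ?_
  rw [dilation_apply, norm_mul, Real.norm_of_nonneg (Real.rpow_pos_of_pos hs _).le]
  have hpow : s ^ d i ≤ r ^ |d i| := by
    rcases le_total 0 (d i) with hi | hi
    · rw [abs_of_nonneg hi]
      exact Real.rpow_le_rpow hs.le hsr hi
    · rw [abs_of_nonpos hi]
      calc s ^ d i = s⁻¹ ^ (-d i) := by rw [Real.inv_rpow hs.le, Real.rpow_neg hs.le, inv_inv]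
        _ ≤ r ^ (-d i) := Real.rpow_le_rpow (inv_pos.2 hs).le hsr' (neg_nonneg.2 hi)
  have hsum : r ^ |d i| ≤ ∑ i, r ^ |d i| :=
    Finset.single_le_sum (f := fun i => r ^ |d i|) (fun j _ => by positivity) (Finset.mem_univ i)
  have hvi := norm_le_pi_norm v i
  gcongr
  linarith

variable {ι N : Type*} [TopologicalSpace N] {D : N → ι → ℝ} {d : ι → ℝ}
  {K : Subgroup ((ι → ℝ) ≃ₗ[ℝ] (ι → ℝ))} {Δ : Subgroup (N ≃ₜ N)} {C : Set N} {κ r : ℝ}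
  [Fintype ι] [T2Space N] (R : IsRaySystem D d K Δ C κ)

namespace IsRaySystem

include R

theorem exists_nhds_forall_apply_mem (r : ℝ) {δ : ℝ} (hδ : 0 < δ) (z : N) :
    ∃ O ∈ 𝓝 z, ∀ (F : N ≃ₜ N) (s), HasScale D d K F s → s ≤ r → s⁻¹ ≤ r → ∀ W : Set N,
      (∀ u, ‖u‖ < δ → ∃ y ∈ W, Reach D (F z) u y) → ∀ z' ∈ O, F z' ∈ W := by
  have hD := R.isLocalHomeomorph
  obtain ⟨Λ, hΛ, hdil⟩ := exists_norm_dilation_le d r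
  have hρ : 0 < δ / κ / Λ := div_pos (div_pos hδ R.pos) hΛ
  obtain ⟨-, -, U, hU, -, hreach⟩ := exists_nhds_reach hD z univ_mem
  refine ⟨U ∩ D ⁻¹' Metric.ball (D z) (δ / κ / Λ), inter_mem hU
    (hD.continuous.continuousAt.preimage_mem_nhds (Metric.ball_mem_nhds _ hρ)), ?_⟩
  rintro F s hF hsr hsr' W hsees z' ⟨hz'U, hz'⟩
  obtain ⟨y, hy, hzy⟩ := R.exists_reach_of_hasScale hF hsees (v := D z' - D z) <|
    (hdil s hF.1 hsr hsr' _).trans_lt <| by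
      rwa [← lt_div_iff₀' hΛ, ← dist_eq_norm]
  rwa [(hreach z (mem_of_mem_nhds hU) z' hz'U).unique hD hzy]

variable {J : Type*} {𝒰 : Ultrafilter J} {F : J → N ≃ₜ N} {c : J → ℝ}

theorem tendsto_prod_nhds (hF : ∀ j, HasScale D d K (F j) (c j))
    (hc : ∀ j, c j ≤ r ∧ (c j)⁻¹ ≤ r) {z p : N} (hz : Tendsto (fun j => F j z) 𝒰 (𝓝 p)) :
    Tendsto (fun q : J × N => F q.1 q.2) ((𝒰 : Filter J) ×ˢ 𝓝 z) (𝓝 p) := by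
  intro W hW
  obtain ⟨δ, hδ, V, hV, hsees, -⟩ := exists_nhds_reach R.isLocalHomeomorph p hW
  obtain ⟨O, hO, h⟩ := R.exists_nhds_forall_apply_mem r hδ z
  refine mem_map.2 (mem_of_superset (prod_mem_prod (mem_map.1 (hz hV)) hO) ?_)
  rintro ⟨j, z'⟩ ⟨hj, hz'⟩
  exact h _ _ (hF j) (hc j).1 (hc j).2 W (hsees _ hj) z' hz'

variable [LocallyCompactSpace N]

theorem exists_isCompact_nhds_apply_mem (hr : HasScaleBound D d K C r) : ∃ C', IsCompact C' ∧
    ∀ z, ∃ O ∈ 𝓝 z, ∀ (F : N ≃ₜ N) (s), HasScale D d K F s → F z ∈ C → ∀ z' ∈ O, F z' ∈ C' := by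
  obtain ⟨C', hC', hCC'⟩ := exists_compact_superset R.isCompact
  obtain ⟨δ, hδ, hsees⟩ := exists_forall_reach_of_isCompact R.isLocalHomeomorph R.isCompact
    (subset_interior_iff_mem_nhdsSet.1 hCC')
  refine ⟨C', hC', fun z => ?_⟩
  obtain ⟨γ, hγ, hγz⟩ := R.cover z
  obtain ⟨t, ht⟩ := R.hasScale γ hγ
  obtain ⟨O, hO, h⟩ := R.exists_nhds_forall_apply_mem r hδ (γ z)
  refine ⟨γ ⁻¹' O, γ.continuous.continuousAt.preimage_mem_nhds hO, fun F s hF hFz z' hz' => ?_⟩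
  have happly : ∀ a, (F * γ⁻¹) (γ a) = F a := fun a => congrArg F (γ.symm_apply_apply a)
  have hscale := R.hasScale_mul hF (R.hasScale_inv ht)
  obtain ⟨hle, hle'⟩ := hr _ _ hscale (γ z) hγz (by rwa [happly])
  have hmem := h _ _ hscale hle hle' C' (by rw [happly]; exact hsees (F z) hFz) (γ z') hz'
  rwa [happly] at hmem

-- Elements `γ j` of `Δ` with `γ j (F j z) ∈ C` also bring all `F j z'` close to `C`. When some
-- `F j z'` converge, only finitely many `γ j` are involved, hence one of them suffices.
theorem exists_nhds_tendsto (hr : HasScaleBound D d K C r)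
    (hF : ∀ j, HasScale D d K (F j) (c j)) (z : N) :
    ∃ O ∈ 𝓝 z, ∀ z' ∈ O, (∃ p, Tendsto (fun j => F j z') 𝒰 (𝓝 p)) →
      ∀ z'' ∈ O, ∃ p, Tendsto (fun j => F j z'') 𝒰 (𝓝 p) := by
  obtain ⟨C', hC', hnhds⟩ := R.exists_isCompact_nhds_apply_mem hr
  choose γ hγ hγC using fun j => R.cover (F j z)
  choose s hs using fun j => R.hasScale (γ j) (hγ j)
  obtain ⟨O, hO, h⟩ := hnhds z
  have hmem : ∀ j, ∀ z' ∈ O, γ j (F j z') ∈ C' := fun j =>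
    h _ _ (R.hasScale_mul (hs j) (hF j)) (hγC j)
  refine ⟨O, hO, fun z' hz' ⟨p, hp⟩ z'' hz'' => ?_⟩
  obtain ⟨W, hW, hpW⟩ := exists_compact_mem_nhds p
  obtain ⟨g, -, hg⟩ := (Ultrafilter.finite_biUnion_mem_iff (R.finite W C' hW hC')
    (s := fun g => {j | γ j = g}) (f := 𝒰)).1 (by
      filter_upwards [hp hpW] with j hj
      exact mem_biUnion (x := γ j) ⟨hγ j, _, hj, hmem j z' hz'⟩ rfl)
  have hgC' : ∀ᶠ j in (𝒰 : Filter J), F j z'' ∈ g ⁻¹' C' := by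
    filter_upwards [hg] with j hj
    exact hj ▸ hmem j z'' hz''
  obtain ⟨q, -, hq⟩ := (g.isCompact_preimage.2 hC').ultrafilter_le_nhds
    (𝒰.map fun j => F j z'') (le_principal_iff.2 hgC')
  exact ⟨q, hq⟩

theorem exists_tendsto [PreconnectedSpace N] {x y : N} (hr : HasScaleBound D d K C r)
    (hF : ∀ j, HasScale D d K (F j) (c j)) (hx : Tendsto (fun j => F j x) 𝒰 (𝓝 y)) (z : N) :
    ∃ p, Tendsto (fun j => F j z) 𝒰 (𝓝 p) := by
  have hconst : IsLocallyConstant fun z => ∃ p, Tendsto (fun j => F j z) 𝒰 (𝓝 p) := by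
    refine (IsLocallyConstant.iff_eventually_eq _).2 fun a => ?_
    obtain ⟨O, hO, h⟩ := R.exists_nhds_tendsto hr hF (𝒰 := 𝒰) a
    filter_upwards [hO] with b hb
    have ha := mem_of_mem_nhds hO
    exact propext ⟨fun hb' => h b hb hb' a ha, fun ha' => h a ha ha' b hb⟩
  exact hconst.apply_eq_of_preconnectedSpace x z ▸ ⟨y, hx⟩

end IsRaySystem

end Limits

/-! ### Lifts and deck transformations -/

section Lifts

variable {n : ℕ} {M N : Type*}
  [TopologicalSpace M] [ChartedSpace (Model n) M]
  [TopologicalSpace N] [ChartedSpace (Model n) N]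

namespace UniversalCovering

variable (π : UniversalCovering n N M)

theorem continuous_proj : Continuous π.proj := π.isCoveringMap.continuous

variable {π} in
theorem IsLift.symm {F : N ≃ₜ N} {f : M ≃ₜ M} (hF : π.IsLift F f) :
    π.IsLift F.symm f.symm :=
  ⟨F.symm.continuous, fun x => by rw [f.eq_symm_apply, ← hF.2, F.apply_symm_apply]⟩

variable {π} in
theorem IsLift.exists_homeomorph {F : N → N} {f : M ≃ₜ M} (hF : π.IsLift F f) :
    ∃ e : N ≃ₜ N, ⇑e = F := by
  obtain ⟨H, hH, hHF, hFH⟩ := π.exists_lift_inverse f hF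
  exact ⟨⟨⟨F, H, hHF, hFH⟩, hF.1, hH.1⟩, rfl⟩

theorem exists_lift_homeomorph (f : M ≃ₜ M) {x y : N} (h : π.proj y = f (π.proj x)) :
    ∃ F : N ≃ₜ N, π.IsLift F f ∧ F x = y := by
  obtain ⟨F, hF, hxy⟩ := π.exists_lift f h
  obtain ⟨F, rfl⟩ := hF.exists_homeomorph
  exact ⟨F, hF, hxy⟩

theorem eq_of_proj_comp_eq {F F' : N → N} (hF : Continuous F) (hF' : Continuous F')
    (h : ∀ z, π.proj (F z) = π.proj (F' z)) {x : N} (hx : F x = F' x) : F = F' :=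
  have := π.simplyConnected
  π.isCoveringMap.eq_of_comp_eq hF hF' (funext h) x hx

theorem deck_ext {γ γ' : N ≃ₜ N} (hγ : γ ∈ π.deck) (hγ' : γ' ∈ π.deck) {x : N}
    (h : γ x = γ' x) : γ = γ' :=
  DFunLike.coe_injective <| π.eq_of_proj_comp_eq γ.continuous γ'.continuous
    (fun z => (hγ z).trans (hγ' z).symm) h

theorem exists_deck {x y : N} (h : π.proj y = π.proj x) : ∃ γ ∈ π.deck, γ x = y := by
  obtain ⟨F, hF, hxy⟩ := π.exists_lift_homeomorph (Homeomorph.refl M) h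
  exact ⟨F, hF.2, hxy⟩

theorem exists_deck_eq_comp {f : M → M} {F F' : N → N} (hF : π.IsLift F f)
    (hF' : π.IsLift F' f) : ∃ γ ∈ π.deck, ∀ x, F' x = γ (F x) := by
  have := π.simplyConnected
  obtain ⟨x⟩ : Nonempty N := inferInstance
  obtain ⟨γ, hγ, hγx⟩ := π.exists_deck (x := F x) (y := F' x) (by rw [hF.2, hF'.2])
  refine ⟨γ, hγ, congrFun (π.eq_of_proj_comp_eq hF'.1 (γ.continuous.comp hF.1) (fun z => ?_)
    hγx.symm)⟩
  rw [hF'.2, hγ, hF.2]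

theorem conj_mem_deck {F : N ≃ₜ N} {f : M ≃ₜ M} (hF : π.IsLift F f) {γ : N ≃ₜ N}
    (hγ : γ ∈ π.deck) : F * γ * F⁻¹ ∈ π.deck := fun x => by
  change π.proj (F (γ (F.symm x))) = π.proj x
  rw [hF.2, hγ, hF.symm.2, f.apply_symm_apply]

include π in
theorem t2Space [T2Space M] : T2Space N := by
  refine ⟨fun x y hxy => ?_⟩
  by_cases h : π.proj x = π.proj y
  · exact π.isCoveringMap.isSeparatedMap x y h hxy
  · exact separated_by_continuous π.continuous_proj h

theorem exists_nhds_finite_deck [T2Space M] (a : N × N) :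
    ∃ U ∈ 𝓝 a, {γ | γ ∈ π.deck ∧ ∃ x, (x, γ x) ∈ U}.Finite := by
  obtain ⟨p, q⟩ := a
  by_cases hpq : π.proj q = π.proj p
  · obtain ⟨γ₀, hγ₀, rfl⟩ := π.exists_deck hpq
    obtain ⟨U, hU, hqU, hinj⟩ := π.isCoveringMap.isLocalHomeomorph.isLocallyInjective (γ₀ p)
    refine ⟨(γ₀ ⁻¹' U) ×ˢ U, prod_mem_nhds
      (γ₀.continuous.continuousAt.preimage_mem_nhds (hU.mem_nhds hqU)) (hU.mem_nhds hqU),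
      (finite_singleton γ₀).subset ?_⟩
    rintro γ ⟨hγ, x, hx, hγx⟩
    exact π.deck_ext hγ hγ₀ (hinj hγx hx ((hγ x).trans (hγ₀ x).symm))
  · obtain ⟨U, V, hU, hV, hqU, hpV, hd⟩ := t2_separation hpq
    refine ⟨(π.proj ⁻¹' V) ×ˢ (π.proj ⁻¹' U), prod_mem_nhds
      (π.continuous_proj.continuousAt.preimage_mem_nhds (hV.mem_nhds hpV))
      (π.continuous_proj.continuousAt.preimage_mem_nhds (hU.mem_nhds hqU)),
      finite_empty.subset ?_⟩
    rintro γ ⟨hγ, x, hx, hγx⟩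
    rw [mem_preimage, hγ x] at hγx
    exact disjoint_left.1 hd hγx hx

theorem finite_deck [T2Space M] {C₁ C₂ : Set N} (h₁ : IsCompact C₁) (h₂ : IsCompact C₂) :
    {γ | γ ∈ π.deck ∧ ∃ x ∈ C₁, γ x ∈ C₂}.Finite := by
  choose U hU hfin using π.exists_nhds_finite_deck
  obtain ⟨t, -, ht⟩ := (h₁.prod h₂).elim_nhds_subcover U fun a _ => hU a
  refine (t.finite_toSet.biUnion fun a _ => hfin a).subset ?_
  rintro γ ⟨hγ, x, hx, hγx⟩
  obtain ⟨a, ha, hxa⟩ := mem_iUnion₂.1 (ht (mk_mem_prod hx hγx))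
  exact mem_biUnion ha ⟨hγ, x, hxa⟩

theorem exists_isCompact_image_eq_univ [CompactSpace M] [LocallyCompactSpace N] :
    ∃ C : Set N, IsCompact C ∧ π.proj '' C = univ := by
  choose σ hσ using π.surjective
  choose W hW hσW using fun m => exists_compact_mem_nhds (σ m)
  have hproj : ∀ m, π.proj '' W m ∈ 𝓝 m := fun m => by
    simpa only [hσ] using π.isCoveringMap.isOpenMap.image_mem_nhds (hσW m)
  obtain ⟨t, -, ht⟩ := isCompact_univ.elim_nhds_subcover (fun m => π.proj '' W m) fun m _ => hproj m
  exact ⟨⋃ m ∈ t, W m, t.isCompact_biUnion fun m _ => hW m,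
    univ_subset_iff.1 (by simpa only [image_iUnion] using ht)⟩

end UniversalCovering

end Lifts

/-! ### Smooth maps and local diffeomorphisms -/

section Smooth

variable {𝕜 : Type*} [NontriviallyNormedField 𝕜]
  {V₁ V₂ V₃ : Type*} [NormedAddCommGroup V₁] [NormedSpace 𝕜 V₁] [NormedAddCommGroup V₂]
  [NormedSpace 𝕜 V₂] [NormedAddCommGroup V₃] [NormedSpace 𝕜 V₃]
  {H₁ H₂ H₃ : Type*} [TopologicalSpace H₁] [TopologicalSpace H₂] [TopologicalSpace H₃]
  {I₁ : ModelWithCorners 𝕜 V₁ H₁} {I₂ : ModelWithCorners 𝕜 V₂ H₂} {I₃ : ModelWithCorners 𝕜 V₃ H₃}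
  {M₁ M₂ M₃ : Type*} [TopologicalSpace M₁] [ChartedSpace H₁ M₁] [TopologicalSpace M₂]
  [ChartedSpace H₂ M₂] [TopologicalSpace M₃] [ChartedSpace H₃ M₃] {k : ℕ∞ω}

theorem contMDiff_of_isLocalDiffeomorph_comp_left {p : M₂ → M₃}
    (hp : IsLocalDiffeomorph I₂ I₃ k p) {F : M₁ → M₂} (hF : Continuous F)
    (h : ContMDiff I₁ I₃ k (p ∘ F)) : ContMDiff I₁ I₂ k F := fun x =>
  ((hp (F x)).localInverse_contMDiffAt.comp x (h x)).congr_of_eventuallyEq <|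
    (hF.continuousAt.eventually (hp (F x)).localInverse_eventuallyEq_left).mono fun _ hy => hy.symm

theorem contMDiff_of_comp_isLocalDiffeomorph {p : M₁ → M₂} (hp : IsLocalDiffeomorph I₁ I₂ k p)
    (hs : Function.Surjective p) {f : M₂ → M₃} (h : ContMDiff I₁ I₃ k (f ∘ p)) :
    ContMDiff I₂ I₃ k f := fun m => by
  obtain ⟨x, rfl⟩ := hs m
  refine ((h _).comp (p x) (hp x).localInverse_contMDiffAt).congr_of_eventuallyEq ?_
  filter_upwards [(hp x).localInverse_eventuallyEq_right] with y hy
  exact congrArg f hy.symm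

theorem contMDiff_affineEquiv {n : ℕ} (χ : Aff n) :
    ContMDiff 𝓘(ℝ, Model n) 𝓘(ℝ, Model n) ∞ χ :=
  (ContinuousAffineMap.contDiff
    ⟨χ.toAffineMap, χ.toAffineMap.continuous_of_finiteDimensional⟩).contMDiff

end Smooth

/-! ### Developed maps -/

namespace GStructure

variable {n : ℕ} {M N : Type*}
  [TopologicalSpace M] [ChartedSpace (Model n) M]
  [TopologicalSpace N] [ChartedSpace (Model n) N]
  {G : Subgroup (Aff n)} {π : UniversalCovering n N M} (S : GStructure G π)

theorem isComplete_of_bijective (h : Function.Bijective S.dev) : S.IsComplete :=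
  ⟨S.isLocalDiffeomorph_dev.diffeomorphOfBijective h, rfl⟩

theorem contMDiff_of_lift {f : M → M} {F : N → N} (hF : π.IsLift F f) {χ : Aff n}
    (h : ∀ x, S.dev (F x) = χ (S.dev x)) : ContMDiff 𝓘(ℝ, Model n) 𝓘(ℝ, Model n) ∞ f := by
  have hdevF : ContMDiff 𝓘(ℝ, Model n) 𝓘(ℝ, Model n) ∞ (S.dev ∘ F) :=
    ((contMDiff_affineEquiv χ).comp S.isLocalDiffeomorph_dev.contMDiff).congr h
  have hF' := contMDiff_of_isLocalDiffeomorph_comp_left S.isLocalDiffeomorph_dev hF.1 hdevF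
  exact contMDiff_of_comp_isLocalDiffeomorph π.isLocalDiffeomorph π.surjective <|
    (π.isLocalDiffeomorph.contMDiff.comp hF').congr fun x => (hF.2 x).symm

theorem dev_symm_apply {F : N ≃ₜ N} {χ : G} (h : ∀ x, S.dev (F x) = (χ : Aff n) (S.dev x))
    (x : N) : S.dev (F.symm x) = ((χ⁻¹ : G) : Aff n) (S.dev x) := by
  change _ = (χ : Aff n).symm (S.dev x)
  rw [(χ : Aff n).eq_symm_apply, ← h, F.apply_symm_apply]

theorem conj_hol_mem_range {F : N ≃ₜ N} {f : M ≃ₜ M} (hF : π.IsLift F f) {χ : G}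
    (h : ∀ x, S.dev (F x) = (χ : Aff n) (S.dev x)) {g : G} (hg : g ∈ S.hol.range) :
    χ * g * χ⁻¹ ∈ S.hol.range := by
  obtain ⟨γ, rfl⟩ := hg
  refine ⟨⟨F * γ * F⁻¹, π.conj_mem_deck hF γ.2⟩, Subtype.ext (S.eq_of_dev fun x => ?_)⟩
  rw [← S.dev_deck]
  change S.dev (F ((γ : N ≃ₜ N) (F.symm x))) =
    (χ : Aff n) ((S.hol γ : Aff n) (((χ⁻¹ : G) : Aff n) (S.dev x)))
  rw [h, S.dev_deck, S.dev_symm_apply h]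

theorem mem_normalizer_of_lift {F : N ≃ₜ N} {f : M ≃ₜ M} (hF : π.IsLift F f) {χ : G}
    (h : ∀ x, S.dev (F x) = (χ : Aff n) (S.dev x)) : χ ∈ S.normalizer := by
  refine Subgroup.mem_normalizer_iff.2 fun g => ⟨S.conj_hol_mem_range hF h, fun hg => ?_⟩
  have hconj := S.conj_hol_mem_range hF.symm (S.dev_symm_apply h) hg
  rwa [show χ⁻¹ * (χ * g * χ⁻¹) * χ⁻¹⁻¹ = g by group] at hconj

theorem isAutomorphism_of_lift {F : N ≃ₜ N} {f : M ≃ₜ M} (hF : π.IsLift F f) {χ : G}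
    (h : ∀ x, S.dev (F x) = (χ : Aff n) (S.dev x)) : S.IsAutomorphism f := by
  refine ⟨S.contMDiff_of_lift hF h, S.contMDiff_of_lift hF.symm (S.dev_symm_apply h),
    fun F' hF' => ?_⟩
  obtain ⟨γ, hγ, hF'γ⟩ := π.exists_deck_eq_comp hF hF'
  refine S.existsUnique_of_exists
    (⟨S.hol ⟨γ, hγ⟩, Subgroup.le_normalizer (H := S.hol.range) ⟨_, rfl⟩⟩ *
      ⟨χ, S.mem_normalizer_of_lift hF h⟩) fun x => ?_
  rw [hF'γ, S.dev_deck ⟨γ, hγ⟩, h]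
  rfl

theorem autActsProperly_of_compactSpace [T2Space M] [CompactSpace M] [CompactSpace S.Aut] :
    S.AutActsProperly := by
  have : LocallyCompactSpace M := ChartedSpace.locallyCompactSpace (Model n) M
  have hcoe : Continuous fun f : S.Aut => ((f : M ≃ₜ M) : C(M, M)) := continuous_induced_dom
  have heval : Continuous fun a : C(M, M) × M => a.1 a.2 := by fun_prop
  exact ⟨((heval.comp (hcoe.prodMap continuous_id)).prodMk continuous_snd).isProperMap⟩

end GStructure

/-! ### Continuous convergence -/

section ContinuousConvergence

variable {J X Y : Type*} [TopologicalSpace X] [TopologicalSpace Y] {l : Filter J}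

/-- Continuous convergence of a family of maps along a filter. Together with continuity of the
maps it implies convergence in the compact-open topology, but it does not need a uniform
structure on `Y`. -/
def TendstoContinuously (F : J → X → Y) (F₀ : X → Y) (l : Filter J) : Prop :=
  ∀ x, Tendsto (fun q : J × X => F q.1 q.2) (l ×ˢ 𝓝 x) (𝓝 (F₀ x))

namespace TendstoContinuously

theorem tendsto_apply {F : J → X → Y} {F₀ : X → Y} (h : TendstoContinuously F F₀ l) {u : J → X}
    {x : X} (hu : Tendsto u l (𝓝 x)) : Tendsto (fun j => F j (u j)) l (𝓝 (F₀ x)) :=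
  (h x).comp (tendsto_id.prodMk hu)

theorem tendsto {F : J → X → Y} {F₀ : X → Y} (h : TendstoContinuously F F₀ l) (x : X) :
    Tendsto (fun j => F j x) l (𝓝 (F₀ x)) :=
  h.tendsto_apply tendsto_const_nhds

theorem continuous [RegularSpace Y] [l.NeBot] {F : J → X → Y} {F₀ : X → Y}
    (h : TendstoContinuously F F₀ l) : Continuous F₀ := by
  refine continuous_iff_continuousAt.2 fun x => (closed_nhds_basis (F₀ x)).tendsto_right_iff.2 ?_
  rintro W ⟨hW, hWc⟩
  filter_upwards [(eventually_swap_iff.1 (h x hW)).curry] with z hz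
  exact hWc.mem_of_tendsto (h.tendsto z) hz

theorem leftInverse [T2Space X] [l.NeBot] {F : J → X → Y} {F₀ : X → Y} {H : J → Y → X}
    {H₀ : Y → X} (hF : TendstoContinuously F F₀ l) (hH : TendstoContinuously H H₀ l)
    (h : ∀ j, Function.LeftInverse (H j) (F j)) : Function.LeftInverse H₀ F₀ := fun x =>
  tendsto_nhds_unique (hH.tendsto_apply (hF.tendsto x)) <|
    tendsto_const_nhds.congr fun j => (h j x).symm

theorem descend {X' Y' : Type*} [TopologicalSpace X'] [TopologicalSpace Y'] {p : X → X'}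
    (hp : IsOpenQuotientMap p) {q : Y → Y'} (hq : Continuous q) {F : J → X → Y} {F₀ : X → Y}
    (h : TendstoContinuously F F₀ l) {f : J → X' → Y'} (hF : ∀ j x, q (F j x) = f j (p x))
    {f₀ : X' → Y'} (hF₀ : ∀ x, q (F₀ x) = f₀ (p x)) : TendstoContinuously f f₀ l := fun x' => by
  obtain ⟨x, rfl⟩ := hp.surjective x'
  have hmap : l ×ˢ 𝓝 (p x) = map (Prod.map id p) (l ×ˢ 𝓝 x) := by
    rw [← prod_map_map_eq', map_id, hp.map_nhds_eq]
  rw [hmap, tendsto_map'_iff, ← hF₀]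
  exact ((hq.tendsto _).comp (h x)).congr fun a => hF a.1 a.2

theorem tendsto_compactOpen {F : J → C(X, Y)} {F₀ : C(X, Y)}
    (h : TendstoContinuously (fun j => F j) F₀ l) : Tendsto F l (𝓝 F₀) := by
  refine ContinuousMap.tendsto_nhds_compactOpen.2 fun K hK U hU hKU => ?_
  have hmem : ∀ᶠ q : J × X in l ×ˢ 𝓝ˢ K, F q.1 q.2 ∈ U :=
    hK.mem_prod_nhdsSet_of_forall fun x hx => h x (hU.mem_nhds (hKU hx))
  exact hmem.curry.mono fun j hj => hj.self_of_nhdsSet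

end TendstoContinuously

theorem UniversalCovering.exists_tendstoContinuously {n : ℕ} {M N : Type*} [TopologicalSpace M]
    [ChartedSpace (Model n) M] [TopologicalSpace N] [ChartedSpace (Model n) N] [T2Space M]
    [l.NeBot] (π : UniversalCovering n N M) {f : J → M → M} {F : J → N → N} {F₀ : N → N}
    (hF : ∀ j, π.IsLift (F j) (f j)) (hF₀ : TendstoContinuously F F₀ l) :
    ∃ g : M → M, (∀ x, π.proj (F₀ x) = g (π.proj x)) ∧ TendstoContinuously f g l := by
  have hlim (x : N) : Tendsto (fun j => f j (π.proj x)) l (𝓝 (π.proj (F₀ x))) :=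
    ((π.continuous_proj.tendsto _).comp (hF₀.tendsto x)).congr fun j => (hF j).2 x
  obtain ⟨σ, hσ⟩ := π.surjective.hasRightInverse
  let g : M → M := fun m => π.proj (F₀ (σ m))
  have hg (x : N) : π.proj (F₀ x) = g (π.proj x) :=
    tendsto_nhds_unique (hlim x) (by simpa only [hσ (π.proj x)] using hlim (σ (π.proj x)))
  exact ⟨g, hg, hF₀.descend
    ⟨π.surjective, π.continuous_proj, π.isCoveringMap.isOpenMap⟩ π.continuous_proj
    (fun j => (hF j).2) hg⟩

end ContinuousConvergence

section LimitScale

theorem tendsto_dilation {ι J : Type*} (d : ι → ℝ) {l : Filter J} {c : J → ℝ} {s : ℝ} (hs : s ≠ 0)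
    (hc : Tendsto c l (𝓝 s)) (v : ι → ℝ) :
    Tendsto (fun j => dilation d (c j) v) l (𝓝 (dilation d s v)) :=
  tendsto_pi_nhds.2 fun i => (hc.rpow_const (Or.inl hs)).mul_const (v i)

theorem exists_hasScale_of_tendsto {ι N J : Type*} [Finite ι] [TopologicalSpace N]
    {D : N → ι → ℝ} {d : ι → ℝ} {K : Subgroup ((ι → ℝ) ≃ₗ[ℝ] (ι → ℝ))} (hD : Continuous D)
    (hK : IsCompact ((fun k : (ι → ℝ) ≃ₗ[ℝ] (ι → ℝ) =>
      LinearMap.toContinuousLinearMap (k : (ι → ℝ) →ₗ[ℝ] (ι → ℝ))) '' (K : Set _)))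
    {𝒰 : Ultrafilter J} {F : J → N → N} {F₀ : N → N} {c : J → ℝ} {r : ℝ}
    (hF : ∀ j, HasScale D d K (F j) (c j)) (hc : ∀ j, c j ≤ r ∧ (c j)⁻¹ ≤ r)
    (hlim : ∀ z, Tendsto (fun j => F j z) 𝒰 (𝓝 (F₀ z))) : ∃ s, HasScale D d K F₀ s := by
  have := Fintype.ofFinite ι
  choose hc₀ k hk hkF using hF
  obtain ⟨j₀⟩ : Nonempty J := (𝒰 : Filter J).nonempty_of_neBot
  have hr : 0 < r := (hc₀ j₀).trans_le (hc j₀).1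
  obtain ⟨s, ⟨hrs, -⟩, hs⟩ := (isCompact_Icc (a := r⁻¹) (b := r)).ultrafilter_le_nhds (𝒰.map c)
    (tendsto_principal.2 <| .of_forall fun j => ⟨inv_le_of_inv_le₀ (hc₀ j) (hc j).2, (hc j).1⟩)
  have hs₀ : 0 < s := (inv_pos.2 hr).trans_le hrs
  obtain ⟨-, ⟨k₀, hk₀, rfl⟩, hk₀lim⟩ := hK.ultrafilter_le_nhds (𝒰.map fun j =>
    LinearMap.toContinuousLinearMap (k j : (ι → ℝ) →ₗ[ℝ] (ι → ℝ)))
    (tendsto_principal.2 <| .of_forall fun j => mem_image_of_mem _ (hk j))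
  have hlin (v : ι → ℝ) : Tendsto (fun j => k j (dilation d (c j) v)) 𝒰
      (𝓝 (k₀ (dilation d s v))) :=
    (isBoundedBilinearMap_apply.continuous.tendsto (_, _)).comp
      (Tendsto.prodMk_nhds hk₀lim (tendsto_dilation d hs₀.ne' hs v))
  refine ⟨s, hs₀, k₀, hk₀, fun x y => tendsto_nhds_unique
    (((hD.tendsto _).comp (hlim y)).sub ((hD.tendsto _).comp (hlim x))) ?_⟩
  exact (hlin _).congr fun j => (hkF j x y).symm

end LimitScale

/-! ### Ray geometries of rank one -/

/-- Conjugation by a linear equivalence, which transports a linear group of `V` to one of `W`. -/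
def linearEquivConj {R V W : Type*} [Semiring R] [AddCommMonoid V] [Module R V] [AddCommMonoid W]
    [Module R W] (φ : V ≃ₗ[R] W) : (V ≃ₗ[R] V) →* (W ≃ₗ[R] W) :=
  MonoidHom.mk' (fun k => φ.symm.trans (k.trans φ)) fun k k' => by
    ext w
    simp [LinearEquiv.mul_apply]

@[simp]
theorem linearEquivConj_apply {R V W : Type*} [Semiring R] [AddCommMonoid V] [Module R V]
    [AddCommMonoid W] [Module R W] (φ : V ≃ₗ[R] W) (k : V ≃ₗ[R] V) (w : W) :
    linearEquivConj φ k w = φ (k (φ.symm w)) := rfl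

/-- A dilation of positive ratio as a linear equivalence. -/
def dilationEquiv {ι : Type*} (d : ι → ℝ) (s : ℝ) (hs : 0 < s) : (ι → ℝ) ≃ₗ[ℝ] (ι → ℝ) :=
  LinearEquiv.ofLinearMap (dilation d s) (dilation d s⁻¹)
    (LinearMap.ext (dilation_dilation_inv d hs)) (LinearMap.ext (dilation_inv_dilation d hs))

theorem forall_apply_basis_iff {ι V : Type*} [Finite ι] [AddCommGroup V] [Module ℝ V]
    (b : Module.Basis ι ℝ V) (d : ι → ℝ) (s : ℝ) (a : V →ₗ[ℝ] V) :
    (∀ i, a (b i) = s ^ d i • b i) ↔ ∀ v, b.equivFun (a v) = dilation d s (b.equivFun v) := by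
  classical
  have hb (i : ι) : b.equivFun (s ^ d i • b i) = dilation d s (b.equivFun (b i)) := by
    have hsingle : b.equivFun (b i) = Pi.single i 1 := by
      ext j
      rw [b.equivFun_self, Pi.single_apply]
      exact if_congr eq_comm rfl rfl
    rw [map_smul, hsingle, dilation_single]
  refine ⟨fun h => LinearMap.congr_fun (f := b.equivFun.toLinearMap ∘ₗ a)
    (g := dilation d s ∘ₗ b.equivFun.toLinearMap) (b.ext fun i => ?_),
    fun h i => b.equivFun.injective ((h _).trans (hb i).symm)⟩
  exact (congrArg b.equivFun (h i)).trans (hb i)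

namespace RayGeometry

theorem exists_eq_mul_of_mem_sup {n r : ℕ} (𝒢 : RayGeometry n r) {g : Model n ≃ₗ[ℝ] Model n}
    (hg : g ∈ 𝒢.K ⊔ 𝒢.A) : ∃ k ∈ 𝒢.K, ∃ a ∈ 𝒢.A, k * a = g := by
  have hnorm : 𝒢.K ≤ Subgroup.normalizer 𝒢.A := Subgroup.le_normalizer_iff.2 fun k hk a ha => by
    rwa [𝒢.commute k hk a ha, mul_inv_cancel_right]
  rw [← SetLike.mem_coe, Subgroup.coe_mul_of_left_le_normalizer_right _ _ hnorm] at hg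
  exact hg

variable {n : ℕ} (𝒢 : RayGeometry n 1)

/-- The exponents of the one-parameter group `A` of a ray geometry of rank one. -/
def weight (i : Fin n) : ℝ := 𝒢.exponent 0 i

/-- The compact group `K`, in the coordinates of the basis. -/
def coordK : Subgroup ((Fin n → ℝ) ≃ₗ[ℝ] (Fin n → ℝ)) :=
  𝒢.K.map (linearEquivConj 𝒢.basis.equivFun)

theorem exists_weight_ne_zero : ∃ i, 𝒢.weight i ≠ 0 := by
  by_contra! h
  have h12 := 𝒢.injOn_param (x₁ := fun _ => 1) (x₂ := fun _ => 2) (fun _ => one_pos)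
    (fun _ => two_pos) (funext fun i => by
      have : 𝒢.exponent 0 i = 0 := h i
      simp [this])
  simpa using congrFun h12 0

theorem mem_A_iff {a : Model n ≃ₗ[ℝ] Model n} : a ∈ 𝒢.A ↔ ∃ s, 0 < s ∧
    ∀ v, 𝒢.basis.equivFun (a v) = dilation 𝒢.weight s (𝒢.basis.equivFun v) := by
  have hiff (s : ℝ) := forall_apply_basis_iff 𝒢.basis 𝒢.weight s (a : Model n →ₗ[ℝ] Model n)
  constructor
  · rintro ⟨β, hβ, ha⟩
    refine ⟨β 0, hβ 0, (hiff (β 0)).1 fun i => (ha i).trans ?_⟩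
    rw [Fin.prod_univ_one, weight]
  · rintro ⟨s, hs, ha⟩
    refine ⟨fun _ => s, fun _ => hs, fun i => ((hiff s).2 ha i).trans ?_⟩
    rw [Fin.prod_univ_one, weight]

theorem conj_dilationEquiv_mem_A {s : ℝ} (hs : 0 < s) :
    linearEquivConj 𝒢.basis.equivFun.symm (dilationEquiv 𝒢.weight s hs) ∈ 𝒢.A :=
  𝒢.mem_A_iff.2 ⟨s, hs, fun v => by
    rw [linearEquivConj_apply, LinearEquiv.apply_symm_apply]
    rfl⟩

theorem coordK_comm_dilation {k : (Fin n → ℝ) ≃ₗ[ℝ] (Fin n → ℝ)} (hk : k ∈ 𝒢.coordK) {s : ℝ}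
    (hs : 0 < s) (v : Fin n → ℝ) :
    k (dilation 𝒢.weight s v) = dilation 𝒢.weight s (k v) := by
  obtain ⟨k, hk, rfl⟩ := hk
  have hcomm := LinearEquiv.congr_fun (𝒢.commute k hk _ (𝒢.conj_dilationEquiv_mem_A hs))
    (𝒢.basis.equivFun.symm v)
  simp only [LinearEquiv.mul_apply, linearEquivConj_apply, LinearEquiv.symm_symm,
    LinearEquiv.apply_symm_apply] at hcomm
  exact 𝒢.basis.equivFun.eq_symm_apply.1 hcomm

theorem isCompact_coordK : IsCompact ((fun k : (Fin n → ℝ) ≃ₗ[ℝ] (Fin n → ℝ) =>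
    LinearMap.toContinuousLinearMap (k : (Fin n → ℝ) →ₗ[ℝ] (Fin n → ℝ))) ''
      (𝒢.coordK : Set _)) := by
  have himage := 𝒢.isCompact_K.image 𝒢.basis.equivFunL.conjContinuousAlgEquiv.continuous
  rw [image_image] at himage
  rw [coordK, Subgroup.coe_map, image_image]
  exact himage

theorem exists_norm_le_of_mem_coordK :
    ∃ κ > 0, ∀ k ∈ 𝒢.coordK, ∀ v, ‖k v‖ ≤ κ * ‖v‖ := by
  obtain ⟨κ, hκ, h⟩ := 𝒢.isCompact_coordK.isBounded.exists_pos_norm_le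
  exact ⟨κ, hκ, fun k hk v => (ContinuousLinearMap.le_of_opNorm_le _ (h _ ⟨k, hk, rfl⟩) v)⟩

end RayGeometry

namespace GStructure

variable {n : ℕ} {𝒢 : RayGeometry n 1} {M N : Type*}
  [TopologicalSpace M] [ChartedSpace (Model n) M]
  [TopologicalSpace N] [ChartedSpace (Model n) N]
  {π : UniversalCovering n N M} (S : GStructure 𝒢.G π)

/-- The developing map, in the coordinates of the basis. -/
def coordDev (x : N) : Fin n → ℝ := 𝒢.basis.equivFun (S.dev x)

theorem isLocalHomeomorph_coordDev : IsLocalHomeomorph S.coordDev :=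
  𝒢.basis.equivFunL.toHomeomorph.isLocalHomeomorph.comp S.isLocalDiffeomorph_dev.isLocalHomeomorph

theorem exists_hasScale_of_dev {F : N → N} {χ : Aff n} (hχ : χ ∈ 𝒢.G)
    (h : ∀ x, S.dev (F x) = χ (S.dev x)) : ∃ s, HasScale S.coordDev 𝒢.weight 𝒢.coordK F s := by
  obtain ⟨k, hk, a, ha, hka⟩ := 𝒢.exists_eq_mul_of_mem_sup hχ
  obtain ⟨s, hs, has⟩ := 𝒢.mem_A_iff.1 ha
  refine ⟨s, hs, linearEquivConj 𝒢.basis.equivFun k, ⟨k, hk, rfl⟩, fun x y => ?_⟩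
  have hlin : S.dev (F y) - S.dev (F x) = k (a (S.dev y - S.dev x)) := by
    rw [h, h, ← LinearEquiv.mul_apply, hka]
    exact (AffineMap.linearMap_vsub χ.toAffineMap (S.dev y) (S.dev x)).symm
  simp only [coordDev, ← map_sub, hlin, linearEquivConj_apply, ← has, LinearEquiv.symm_apply_apply]

theorem exists_dev_eq_of_hasScale [Nonempty N] {F : N → N} {s : ℝ}
    (h : HasScale S.coordDev 𝒢.weight 𝒢.coordK F s) :
    ∃ χ : 𝒢.G, ∀ x, S.dev (F x) = (χ : Aff n) (S.dev x) := by
  obtain ⟨hs, _, ⟨k, hk, rfl⟩, h⟩ := h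
  obtain ⟨x₀⟩ := ‹Nonempty N›
  set L := k * linearEquivConj 𝒢.basis.equivFun.symm (dilationEquiv 𝒢.weight s hs)
  have hlin (x : N) : S.dev (F x) - S.dev (F x₀) = L (S.dev x - S.dev x₀) := by
    refine 𝒢.basis.equivFun.injective ?_
    rw [map_sub]
    refine (h x₀ x).trans ?_
    rw [coordDev, coordDev, ← map_sub]
    rfl
  let χ : Aff n := L.toAffineEquiv.trans
    (AffineEquiv.constVAdd ℝ (Model n) (S.dev (F x₀) - L (S.dev x₀)))
  have hχL : AffineEquiv.linearHom χ = L := LinearEquiv.ext fun _ => rfl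
  have hχ : χ ∈ 𝒢.G := by
    rw [RayGeometry.G, Subgroup.mem_comap, hχL]
    exact Subgroup.mul_mem_sup hk (𝒢.conj_dilationEquiv_mem_A hs)
  refine ⟨⟨χ, hχ⟩, fun x => ?_⟩
  change _ = S.dev (F x₀) - L (S.dev x₀) + L (S.dev x)
  rw [sub_add_comm, ← map_sub, ← hlin, sub_add_cancel]

theorem exists_isRaySystem [T2Space M] [CompactSpace M] :
    ∃ C κ, IsRaySystem S.coordDev 𝒢.weight 𝒢.coordK π.deck C κ := by
  have : LocallyCompactSpace N := ChartedSpace.locallyCompactSpace (Model n) N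
  obtain ⟨C, hC, hcov⟩ := π.exists_isCompact_image_eq_univ
  obtain ⟨κ, hκ, hbound⟩ := 𝒢.exists_norm_le_of_mem_coordK
  refine ⟨C, κ, S.isLocalHomeomorph_coordDev, hC, fun x => ?_, hκ, hbound,
    fun k hk s hs => 𝒢.coordK_comm_dilation hk hs,
    fun γ hγ => S.exists_hasScale_of_dev (S.hol ⟨γ, hγ⟩).2 (S.dev_deck ⟨γ, hγ⟩),
    fun _ _ => π.finite_deck, 𝒢.exists_weight_ne_zero⟩
  obtain ⟨y, hy, hyx⟩ := hcov.ge (mem_univ (π.proj x))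
  obtain ⟨γ, hγ, rfl⟩ := π.exists_deck hyx
  exact ⟨γ, hγ, hy⟩

/-! ### Compactness of the automorphism group -/

variable {C : Set N} {κ r : ℝ}

theorem exists_lift_apply_mem (R : IsRaySystem S.coordDev 𝒢.weight 𝒢.coordK π.deck C κ)
    (f : S.Aut) (x : N) : ∃ F : N ≃ₜ N, π.IsLift F (f : M ≃ₜ M) ∧ F x ∈ C ∧
      ∃ s, HasScale S.coordDev 𝒢.weight 𝒢.coordK F s := by
  obtain ⟨y, hy⟩ := π.surjective ((f : M ≃ₜ M) (π.proj x))
  obtain ⟨γ, hγ, hγC⟩ := R.cover y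
  obtain ⟨F, hF, hFx⟩ := π.exists_lift_homeomorph (f : M ≃ₜ M) (x := x) (y := γ y)
    ((hγ y).trans hy)
  obtain ⟨χ, hχ, -⟩ := f.2.develops F hF
  exact ⟨F, hF, hFx ▸ hγC, S.exists_hasScale_of_dev (χ : 𝒢.G).2 hχ⟩

theorem exists_tendstoContinuously_lift [T2Space N] [ConnectedSpace N] [LocallyCompactSpace N]
    (R : IsRaySystem S.coordDev 𝒢.weight 𝒢.coordK π.deck C κ)
    (hr : HasScaleBound S.coordDev 𝒢.weight 𝒢.coordK C r) {J : Type*} (𝒰 : Ultrafilter J)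
    (f : J → S.Aut) : ∃ (F : J → N ≃ₜ N) (F₀ : N → N) (χ : 𝒢.G),
      (∀ j, π.IsLift (F j) (f j : M ≃ₜ M)) ∧ TendstoContinuously (fun j => F j) F₀ 𝒰 ∧
      ∀ x, S.dev (F₀ x) = (χ : Aff n) (S.dev x) := by
  obtain ⟨x₀⟩ := (inferInstance : Nonempty N)
  obtain ⟨γ₀, -, hx⟩ := R.cover x₀
  set x := γ₀ x₀
  choose F hF hFC c hc using fun j => S.exists_lift_apply_mem R (f j) x
  have hcr (j : J) : c j ≤ r ∧ (c j)⁻¹ ≤ r := hr (F j) (c j) (hc j) x hx (hFC j)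
  obtain ⟨y, -, hy⟩ := R.isCompact.ultrafilter_le_nhds (𝒰.map fun j => F j x)
    (tendsto_principal.2 <| .of_forall hFC)
  choose F₀ hF₀ using R.exists_tendsto hr hc (𝒰 := 𝒰) hy
  obtain ⟨s, hs⟩ := exists_hasScale_of_tendsto S.isLocalHomeomorph_coordDev.continuous
    𝒢.isCompact_coordK hc hcr hF₀
  obtain ⟨χ, hχ⟩ := S.exists_dev_eq_of_hasScale hs
  exact ⟨F, F₀, χ, hF, fun z => R.tendsto_prod_nhds hc hcr (hF₀ z), hχ⟩

theorem compactSpace_aut [T2Space M] [CompactSpace M]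
    (R : IsRaySystem S.coordDev 𝒢.weight 𝒢.coordK π.deck C κ)
    (hr : HasScaleBound S.coordDev 𝒢.weight 𝒢.coordK C r) : CompactSpace S.Aut := by
  have := π.simplyConnected
  have := π.t2Space
  have : LocallyCompactSpace N := ChartedSpace.locallyCompactSpace (Model n) N
  refine ⟨isCompact_iff_ultrafilter_le_nhds.2 fun 𝒰 _ => ?_⟩
  obtain ⟨F, F₀, χ, hF, hFF₀, hχ⟩ := S.exists_tendstoContinuously_lift R hr 𝒰 id
  obtain ⟨H, H₀, -, hH, hHH₀, -⟩ := S.exists_tendstoContinuously_lift R hr 𝒰 fun f => f⁻¹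
  obtain ⟨g, hg, hfg⟩ := π.exists_tendstoContinuously hF hFF₀
  obtain ⟨h, -, hfh⟩ := π.exists_tendstoContinuously hH hHH₀
  let e : M ≃ₜ M :=
    { toFun := g
      invFun := h
      left_inv := hfg.leftInverse hfh fun f => (f : M ≃ₜ M).symm_apply_apply
      right_inv := hfh.leftInverse hfg fun f => (f : M ≃ₜ M).apply_symm_apply
      continuous_toFun := hfg.continuous
      continuous_invFun := hfh.continuous }
  have hlift : π.IsLift F₀ e := ⟨hFF₀.continuous, hg⟩
  obtain ⟨F₀, rfl⟩ := hlift.exists_homeomorph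
  refine ⟨⟨e, S.isAutomorphism_of_lift hlift hχ⟩, mem_univ _, ?_⟩
  rw [nhds_induced, ← tendsto_iff_comap]
  exact hfg.tendsto_compactOpen

theorem isComplete_of_not_autActsProperly [T2Space M] [CompactSpace M]
    (h : ¬ S.AutActsProperly) : S.IsComplete := by
  have := π.simplyConnected
  have := π.t2Space
  have : LocallyCompactSpace N := ChartedSpace.locallyCompactSpace (Model n) N
  obtain ⟨C, κ, R⟩ := S.exists_isRaySystem
  rcases R.forall_sees_or_exists_hasScaleBound with ⟨x, hx⟩ | ⟨r, hr⟩
  · exact S.isComplete_of_bijective <| (𝒢.basis.equivFun.bijective.of_comp_iff' S.dev).1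
      (bijective_of_forall_sees S.isLocalHomeomorph_coordDev hx)
  · have := S.compactSpace_aut R hr
    exact absurd S.autActsProperly_of_compactSpace h

end GStructure

/-! ### Quotients by discrete subgroups -/

section Quotient

theorem eventually_eq_add_of_mk_eq {E : Type*} [AddCommGroup E] [TopologicalSpace E]
    [IsTopologicalAddGroup E] {Λ : AddSubgroup E} [DiscreteTopology Λ] {φ : E → E} {x : E}
    (hφ : ContinuousAt φ x) (h : ∀ᶠ y in 𝓝 x, (φ y : E ⧸ Λ) = y) :
    ∀ᶠ y in 𝓝 x, φ y = y + (φ x - x) := by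
  have sub_mem {y : E} (hy : (φ y : E ⧸ Λ) = y) : φ y - y ∈ Λ :=
    QuotientAddGroup.eq_iff_sub_mem.1 hy
  obtain ⟨U, hU, hUΛ⟩ : ∃ U ∈ 𝓝 (φ x - x), ∀ v ∈ U, v ∈ Λ → v = φ x - x := by
    have hΛ := isDiscrete_iff_nhdsWithin.1 (DiscreteTopology.isDiscrete (s := (Λ : Set E))) _
      (sub_mem h.self_of_nhds)
    have hsingleton : {φ x - x} ∈ 𝓝[(Λ : Set E)] (φ x - x) := hΛ ▸ mem_pure.2 rfl
    obtain ⟨U, hU, hUs⟩ := mem_nhdsWithin_iff_exists_mem_nhds_inter.1 hsingleton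
    exact ⟨U, hU, fun v hv hvΛ => hUs ⟨hv, hvΛ⟩⟩
  filter_upwards [h, (hφ.sub continuousAt_id) hU] with y hy hyU
  rw [← hUΛ _ hyU (sub_mem hy), Pi.sub_apply, id, add_sub_cancel]

theorem compactSpace_quotient_of_basis_mem {E ι : Type*} [NormedAddCommGroup E] [NormedSpace ℝ E]
    [ProperSpace E] [Finite ι] {Λ : AddSubgroup E} (b : Module.Basis ι ℝ E)
    (hb : ∀ i, b i ∈ Λ) : CompactSpace (E ⧸ Λ) := by
  have := Fintype.ofFinite ι
  obtain ⟨R, hR⟩ := (ZSpan.fundamentalDomain_isBounded b).subset_closedBall 0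
  have hspan : Submodule.span ℤ (range b) ≤ AddSubgroup.toIntSubmodule Λ :=
    Submodule.span_le.2 (range_subset_iff.2 hb)
  have himage : (QuotientAddGroup.mk : E → E ⧸ Λ) '' Metric.closedBall 0 R = univ := by
    refine eq_univ_of_forall fun q => ?_
    obtain ⟨x, rfl⟩ := QuotientAddGroup.mk_surjective q
    refine ⟨ZSpan.fract b x, hR (ZSpan.fract_mem_fundamentalDomain b x), ?_⟩
    rw [eq_comm, QuotientAddGroup.eq_iff_sub_mem, ZSpan.fract_apply, sub_sub_cancel]
    exact hspan (ZSpan.floor b x).2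
  exact ⟨himage ▸ (isCompact_closedBall 0 R).image continuous_quot_mk⟩

variable {n : ℕ} (Λ : AddSubgroup (Model n)) [DiscreteTopology Λ]

theorem isCoveringMap_mk : IsCoveringMap (QuotientAddGroup.mk : Model n → Model n ⧸ Λ) :=
  (Λ.isAddQuotientCoveringMap_of_comm DiscreteTopology.isDiscrete).isCoveringMap

/-- The smooth structure of the quotient by a discrete subgroup: the charts are the local inverses
of the projection. -/
instance instChartedSpaceQuotient : ChartedSpace (Model n) (Model n ⧸ Λ) where
  atlas := {e | ⇑e.symm = QuotientAddGroup.mk}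
  chartAt q := (isCoveringMap_mk Λ).isLocalHomeomorph.localInverseAt q.out
  mem_chart_source q := by
    have h := (isCoveringMap_mk Λ).isLocalHomeomorph.apply_self_mem_localInverseAt_source
      (x := q.out)
    rwa [QuotientAddGroup.out_eq'] at h
  chart_mem_atlas q := (isCoveringMap_mk Λ).isLocalHomeomorph.localInverseAt_symm _

instance instIsManifoldQuotient : IsManifold 𝓘(ℝ, Model n) ∞ (Model n ⧸ Λ) := by
  refine isManifold_of_contDiffOn _ _ _ fun e e' he he' => ?_
  replace he : ⇑e.symm = QuotientAddGroup.mk := he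
  replace he' : ⇑e'.symm = QuotientAddGroup.mk := he'
  simp only [modelWithCornersSelf_coe, modelWithCornersSelf_coe_symm, Function.id_comp,
    Function.comp_id, preimage_id, range_id, inter_univ]
  intro x hx
  have hmk : ∀ y ∈ (e.symm ≫ₕ e').source, ((e.symm ≫ₕ e') y : Model n ⧸ Λ) = y := fun y hy => by
    rw [OpenPartialHomeomorph.trans_source] at hy
    rw [OpenPartialHomeomorph.coe_trans, Function.comp_apply, ← he', e'.left_inv hy.2, he, he']
  have htrans := eventually_eq_add_of_mk_eq ((e.symm ≫ₕ e').continuousAt hx)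
    (mem_of_superset ((e.symm ≫ₕ e').open_source.mem_nhds hx) hmk)
  exact ((contDiff_id.add contDiff_const).contDiffAt.congr_of_eventuallyEq
    htrans).contDiffWithinAt

theorem isLocalDiffeomorph_mk : IsLocalDiffeomorph 𝓘(ℝ, Model n) 𝓘(ℝ, Model n) ∞
    (QuotientAddGroup.mk : Model n → Model n ⧸ Λ) := by
  intro x
  have hmk := (isCoveringMap_mk Λ).isLocalHomeomorph
  let e := hmk.localInverseAt x
  have he : ⇑e.symm = QuotientAddGroup.mk := hmk.localInverseAt_symm x
  have he_mem : e ∈ IsManifold.maximalAtlas 𝓘(ℝ, Model n) ∞ (Model n ⧸ Λ) :=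
    IsManifold.subset_maximalAtlas he
  exact ⟨⟨e.symm.toPartialEquiv, e.open_target, e.open_source,
    contMDiffOn_symm_of_mem_maximalAtlas he_mem, contMDiffOn_of_mem_maximalAtlas he_mem⟩,
    hmk.self_mem_localInverseAt_target, fun y _ => (congrFun he y).symm⟩

/-- The model space as the universal covering of its quotient by a discrete subgroup. -/
def quotientCovering : UniversalCovering n (Model n) (Model n ⧸ Λ) where
  proj := QuotientAddGroup.mk
  simplyConnected := inferInstance
  surjective := QuotientAddGroup.mk_surjective
  isCoveringMap := isCoveringMap_mk Λ
  isLocalDiffeomorph := isLocalDiffeomorph_mk Λ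

variable {Λ}

theorem quotientCovering_deck_zero_mem (γ : (quotientCovering Λ).deck) :
    (γ : Model n ≃ₜ Model n) 0 ∈ Λ := by
  have h : (((γ : Model n ≃ₜ Model n) 0 : Model n) : Model n ⧸ Λ) = (0 : Model n) := γ.2 0
  rwa [QuotientAddGroup.eq_iff_sub_mem, sub_zero] at h

theorem quotientCovering_deck_apply (γ : (quotientCovering Λ).deck) (x : Model n) :
    (γ : Model n ≃ₜ Model n) x = x + (γ : Model n ≃ₜ Model n) 0 := by
  let τ : Model n ≃ₜ Model n := Homeomorph.addRight ((γ : Model n ≃ₜ Model n) 0)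
  have hτ : τ ∈ (quotientCovering Λ).deck := fun y => by
    change ((y + (γ : Model n ≃ₜ Model n) 0 : Model n) : Model n ⧸ Λ) = y
    rw [QuotientAddGroup.eq_iff_sub_mem, add_sub_cancel_left]
    exact quotientCovering_deck_zero_mem γ
  have hγτ : (γ : Model n ≃ₜ Model n) = τ :=
    (quotientCovering Λ).deck_ext γ.2 hτ (x := 0) (zero_add _).symm
  exact congrArg (fun f : Model n ≃ₜ Model n => f x) hγτ

end Quotient

/-! ### An incomplete structure of rank two with a hyperbolic automorphism -/

section RankTwo

open scoped goldenRatio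

theorem eq_of_tendsto_smul {Γ X ι : Type*} [Group Γ] [TopologicalSpace Γ] [TopologicalSpace X]
    [T2Space X] [MulAction Γ X] [ProperSMul Γ X] {l : Filter ι} [l.NeBot] {g : ι → Γ} {u : ι → X}
    {x y z : X} (hu : Tendsto u l (𝓝 x)) (hgu : Tendsto (fun j => g j • u j) l (𝓝 y))
    (hgx : Tendsto (fun j => g j • x) l (𝓝 z)) : y = z := by
  have hle : (Ultrafilter.of l : Filter ι) ≤ l := Ultrafilter.of_le l
  obtain ⟨g₀, hg₀, hg : Tendsto g (Ultrafilter.of l) (𝓝 g₀)⟩ :=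
    (properSMul_iff_continuousSMul_ultrafilter_tendsto.1 ‹_›).2
      ((Ultrafilter.of l).map fun j => (g j, u j)) y x
      ((Tendsto.prodMk_nhds hgu hu).mono_left hle)
  exact hg₀ ▸ tendsto_nhds_unique (hg.smul_const x) (hgx.mono_left hle)

/-- A basis of the lattice `ℤ × {(a, a') | a ∈ ℤ[φ]}`, where `a'` is the conjugate of `a`. -/
def latticeVectors : Fin 3 → Model 3 :=
  ![!₂[1, 0, 0], !₂[0, 1, 1], !₂[0, φ, ψ]]

theorem sum_smul_latticeVectors (c : Fin 3 → ℝ) :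
    ∑ i, c i • latticeVectors i = !₂[c 0, c 1 + c 2 * φ, c 1 + c 2 * ψ] := by
  ext i
  fin_cases i <;> simp [Fin.sum_univ_three, latticeVectors]

theorem linearIndependent_latticeVectors : LinearIndependent ℝ latticeVectors := by
  refine Fintype.linearIndependent_iff.2 fun c hc => ?_
  rw [sum_smul_latticeVectors] at hc
  have h0 : c 0 = 0 := congrArg (fun v : Model 3 => v 0) hc
  have h1 : c 1 + c 2 * φ = 0 := congrArg (fun v : Model 3 => v 1) hc
  have hψ : c 1 + c 2 * ψ = 0 := congrArg (fun v : Model 3 => v 2) hc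
  have hmul : c 2 * (φ - ψ) = 0 := by linear_combination h1 - hψ
  have h2 : c 2 = 0 := (mul_eq_zero.1 hmul).resolve_right <|
    sub_ne_zero.2 (Real.goldenConj_neg.trans Real.goldenRatio_pos).ne'
  rw [h2, zero_mul, add_zero] at h1
  intro i
  fin_cases i <;> assumption

/-- The basis of `ℝ³` formed by `latticeVectors`. -/
def latticeBasis : Module.Basis (Fin 3) ℝ (Model 3) :=
  basisOfLinearIndependentOfCardEqFinrank linearIndependent_latticeVectors
    finrank_euclideanSpace_fin.symm

theorem latticeBasis_apply (i : Fin 3) : latticeBasis i = latticeVectors i :=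
  congrFun (coe_basisOfLinearIndependentOfCardEqFinrank _ _) i

/-- The lattice `ℤ × ℤ[φ]` of `ℝ³`, with `ℤ[φ]` embedded in `ℝ²` by its two real places. -/
def lattice : AddSubgroup (Model 3) :=
  (Submodule.span ℤ (range latticeBasis)).toAddSubgroup

instance : DiscreteTopology lattice :=
  inferInstanceAs (DiscreteTopology (Submodule.span ℤ (range latticeBasis)))

instance : IsClosed (lattice : Set (Model 3)) := AddSubgroup.isClosed_of_discrete

instance : CompactSpace (Model 3 ⧸ lattice) :=
  compactSpace_quotient_of_basis_mem latticeBasis fun i =>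
    Submodule.subset_span (mem_range_self i)

theorem mem_lattice {v : Model 3} : v ∈ lattice ↔
    ∃ a p q : ℤ, v 0 = a ∧ v 1 = p + q * φ ∧ v 2 = p + q * ψ := by
  have hsum (c : Fin 3 → ℤ) : ∑ i, c i • latticeBasis i =
      !₂[(c 0 : ℝ), c 1 + c 2 * φ, c 1 + c 2 * ψ] := by
    rw [← sum_smul_latticeVectors fun i => (c i : ℝ)]
    simp only [latticeBasis_apply, Int.cast_smul_eq_zsmul]
  refine (Submodule.mem_span_range_iff_exists_fun ℤ).trans ?_
  simp only [hsum]
  constructor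
  · rintro ⟨c, rfl⟩
    exact ⟨c 0, c 1, c 2, rfl, rfl, rfl⟩
  · rintro ⟨a, p, q, h0, h1, h2⟩
    refine ⟨![a, p, q], ?_⟩
    ext i
    fin_cases i
    exacts [h0.symm, h1.symm, h2.symm]

/-- The ray geometry of rank two on `ℝ³` in which `A` is the group of all `diag(β₁, β₂, β₂⁻¹)` and
`K` is trivial. -/
def hyperbolicGeometry : RayGeometry 3 2 where
  basis := (EuclideanSpace.basisFun (Fin 3) ℝ).toBasis
  exponent := ![![1, 0, 0], ![0, 1, -1]]
  injOn_param := by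
    intro β _ β' _ h
    have h0 := congrFun h 0
    have h1 := congrFun h 1
    simp only [Fin.prod_univ_two, Matrix.cons_val, Real.rpow_one, Real.rpow_zero, mul_one,
      one_mul] at h0 h1
    ext j
    fin_cases j
    exacts [h0, h1]
  K := ⊥
  isCompact_K := by simp
  commute := by
    rintro k hk a -
    rw [Subgroup.mem_bot.1 hk, one_mul, mul_one]

/-- The linear map `diag(eˢ, eᵗ, e⁻ᵗ)`. -/
def stretch (s t : ℝ) : Model 3 ≃ₗ[ℝ] Model 3 where
  toFun v := !₂[Real.exp s * v 0, Real.exp t * v 1, Real.exp (-t) * v 2]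
  invFun v := !₂[Real.exp (-s) * v 0, Real.exp (-t) * v 1, Real.exp t * v 2]
  map_add' v w := by ext i; fin_cases i <;> simp [mul_add]
  map_smul' r v := by ext i; fin_cases i <;> simp [mul_left_comm]
  left_inv v := by ext i; fin_cases i <;> simp [← mul_assoc, ← Real.exp_add]
  right_inv v := by ext i; fin_cases i <;> simp [← mul_assoc, ← Real.exp_add]

theorem stretch_apply (s t : ℝ) (v : Model 3) :
    stretch s t v = !₂[Real.exp s * v 0, Real.exp t * v 1, Real.exp (-t) * v 2] := rfl

theorem mem_hyperbolicGeometry_G {g : Aff 3} {s t : ℝ} (hg : g.linear = stretch s t) :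
    g ∈ hyperbolicGeometry.G := by
  refine Subgroup.mem_comap.2 (Subgroup.mem_sup_right ?_)
  refine ⟨![Real.exp s, Real.exp t], fun j => ?_, fun i => ?_⟩
  · fin_cases j <;> exact Real.exp_pos _
  · change g.linear _ = _
    rw [hg, stretch_apply]
    ext k
    fin_cases i <;> fin_cases k <;>
      simp [hyperbolicGeometry, Fin.prod_univ_two, Real.rpow_neg_one, Real.exp_neg]

/-- The developing map `(t, y, z) ↦ (eᵗ, y, z)` onto a half space. -/
def expDev (v : Model 3) : Model 3 := !₂[Real.exp (v 0), v 1, v 2]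

theorem isLocalDiffeomorph_expDev :
    IsLocalDiffeomorph 𝓘(ℝ, Model 3) 𝓘(ℝ, Model 3) ∞ expDev := by
  have hcoord (i : Fin 3) (s : Set (Model 3)) : ContDiffOn ℝ ∞ (fun v => v i) s := by fun_prop
  intro x
  refine ⟨⟨⟨expDev, fun v => !₂[Real.log (v 0), v 1, v 2], univ, {v | 0 < v 0},
    fun v _ => Real.exp_pos _, fun _ _ => mem_univ _, fun v _ => ?_, fun v hv => ?_⟩, isOpen_univ,
    isOpen_lt continuous_const (by fun_prop), ?_, ?_⟩, mem_univ x, fun _ _ => rfl⟩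
  · ext i
    fin_cases i <;> simp [expDev]
  · ext i
    fin_cases i <;> simp [expDev, Real.exp_log hv]
  · rw [contMDiffOn_iff_contDiffOn, contDiffOn_euclidean]
    intro i
    fin_cases i
    exacts [ContDiffOn.exp (hcoord 0 _), hcoord 1 _, hcoord 2 _]
  · rw [contMDiffOn_iff_contDiffOn, contDiffOn_euclidean]
    intro i
    fin_cases i
    exacts [ContDiffOn.log (hcoord 0 _) fun v hv => ne_of_gt hv, hcoord 1 _, hcoord 2 _]

/-- The holonomy `(x, y, z) ↦ (e ^ v₀ x, v₁ + y, v₂ + z)` of the translation by `v`. -/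
def translationHol (v : Model 3) : Aff 3 :=
  (stretch (v 0) 0).toAffineEquiv.trans (AffineEquiv.constVAdd ℝ (Model 3) !₂[0, v 1, v 2])

theorem translationHol_apply (v x : Model 3) :
    translationHol v x = !₂[Real.exp (v 0) * x 0, v 1 + x 1, v 2 + x 2] := by
  ext i
  fin_cases i <;> simp [translationHol, stretch_apply]

theorem translationHol_mem (v : Model 3) : translationHol v ∈ hyperbolicGeometry.G :=
  mem_hyperbolicGeometry_G rfl

theorem translationHol_add (v w : Model 3) :
    translationHol (v + w) = translationHol v * translationHol w := by
  ext x i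
  rw [AffineEquiv.mul_def, AffineEquiv.trans_apply]
  simp only [translationHol_apply]
  fin_cases i <;> simp [Real.exp_add, mul_assoc, add_assoc]

theorem expDev_add (v x : Model 3) : expDev (x + v) = translationHol v (expDev x) := by
  rw [translationHol_apply]
  ext i
  fin_cases i <;> simp [expDev, Real.exp_add, add_comm]

/-- The structure of rank two on `ℝ³ ⧸ lattice` with developing map `expDev`. -/
def halfSpaceStructure : GStructure hyperbolicGeometry.G (quotientCovering lattice) where
  dev := expDev
  isLocalDiffeomorph_dev := isLocalDiffeomorph_expDev
  hol := MonoidHom.mk' (fun γ => ⟨translationHol ((γ : Model 3 ≃ₜ Model 3) 0),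
    translationHol_mem _⟩) fun γ γ' => Subtype.ext <| by
      have hmul : ((γ * γ' : (quotientCovering lattice).deck) : Model 3 ≃ₜ Model 3) 0 =
        (γ' : Model 3 ≃ₜ Model 3) 0 + (γ : Model 3 ≃ₜ Model 3) 0 := quotientCovering_deck_apply γ _
      change translationHol _ = translationHol _ * translationHol _
      rw [hmul, add_comm, translationHol_add]
  dev_deck γ x := by
    rw [quotientCovering_deck_apply]
    exact expDev_add _ x

theorem halfSpaceStructure_not_isComplete : ¬ halfSpaceStructure.IsComplete := by
  rintro ⟨Φ, hΦ⟩
  obtain ⟨x, hx⟩ := Φ.surjective 0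
  replace hx : expDev x = 0 := (congrFun hΦ x).symm.trans hx
  exact (Real.exp_pos (x 0)).ne' (congrArg (fun v : Model 3 => v 0) hx)

/-- The hyperbolic map `diag(1, φ², ψ²)`. -/
def hyperbolicMap : Model 3 ≃ₗ[ℝ] Model 3 := stretch 0 (Real.log (φ ^ 2))

theorem hyperbolicMap_apply (v : Model 3) :
    hyperbolicMap v = !₂[v 0, φ ^ 2 * v 1, ψ ^ 2 * v 2] := by
  have hexp : Real.exp (Real.log (φ ^ 2)) = φ ^ 2 := Real.exp_log (pow_pos Real.goldenRatio_pos 2)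
  rw [hyperbolicMap, stretch_apply, Real.exp_neg, hexp, Real.exp_zero, one_mul, ← inv_pow,
    Real.inv_goldenRatio, neg_sq]

theorem hyperbolicMap_mem_lattice {v : Model 3} : hyperbolicMap v ∈ lattice ↔ v ∈ lattice := by
  have hφ := Real.goldenRatio_sq
  have hψ := Real.goldenConj_sq
  have hsum := Real.goldenRatio_add_goldenConj
  have hprod : φ ^ 2 * ψ ^ 2 = 1 := by
    rw [← mul_pow, Real.goldenRatio_mul_goldenConj, neg_one_sq]
  rw [mem_lattice, mem_lattice, hyperbolicMap_apply]
  constructor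
  · rintro ⟨a, p, q, h0, h1, h2⟩
    replace h1 : φ ^ 2 * v 1 = p + q * φ := h1
    replace h2 : ψ ^ 2 * v 2 = p + q * ψ := h2
    refine ⟨a, 2 * p - q, q - p, h0, ?_, ?_⟩ <;> push_cast
    · linear_combination ψ ^ 2 * h1 - v 1 * hprod + (p + q * φ) * (hψ + hsum) - q * hφ
    · linear_combination φ ^ 2 * h2 - v 2 * hprod + (p + q * ψ) * (hφ + hsum) - q * hψ
  · rintro ⟨a, p, q, h0, h1, h2⟩
    refine ⟨a, p + q, p + 2 * q, h0, ?_, ?_⟩ <;> push_cast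
    · change φ ^ 2 * v 1 = _
      rw [h1]
      linear_combination (p + q * φ + q) * hφ
    · change ψ ^ 2 * v 2 = _
      rw [h2]
      linear_combination (p + q * ψ + q) * hψ

/-- The automorphism of `ℝ³ ⧸ lattice` induced by `hyperbolicMap`. -/
def hyperbolicHomeomorph : (Model 3 ⧸ lattice) ≃ₜ (Model 3 ⧸ lattice) where
  toEquiv := (QuotientAddGroup.congr lattice lattice hyperbolicMap.toAddEquiv (by
    ext v
    obtain ⟨w, rfl⟩ := hyperbolicMap.surjective v
    rw [hyperbolicMap_mem_lattice]
    exact ⟨fun ⟨u, hu, h⟩ => hyperbolicMap.injective h ▸ hu, fun h => ⟨w, h, rfl⟩⟩)).toEquiv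
  continuous_toFun := (QuotientAddGroup.isQuotientMap_mk lattice).continuous_iff.2
    (continuous_quot_mk.comp hyperbolicMap.toContinuousLinearEquiv.continuous)
  continuous_invFun := (QuotientAddGroup.isQuotientMap_mk lattice).continuous_iff.2
    (continuous_quot_mk.comp hyperbolicMap.toContinuousLinearEquiv.symm.continuous)

theorem hyperbolicHomeomorph_mem_aut : hyperbolicHomeomorph ∈ halfSpaceStructure.Aut := by
  let F : Model 3 ≃ₜ Model 3 := hyperbolicMap.toContinuousLinearEquiv.toHomeomorph
  have hF : (quotientCovering lattice).IsLift F hyperbolicHomeomorph := ⟨F.continuous, fun _ => rfl⟩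
  let χ : hyperbolicGeometry.G := ⟨hyperbolicMap.toAffineEquiv, mem_hyperbolicGeometry_G rfl⟩
  refine halfSpaceStructure.isAutomorphism_of_lift hF (χ := χ) fun x => ?_
  change expDev (hyperbolicMap x) = hyperbolicMap (expDev x)
  rw [hyperbolicMap_apply, hyperbolicMap_apply]
  rfl

/-- The automorphism `hyperbolicHomeomorph` as an element of the automorphism group. -/
def hyperbolicAut : halfSpaceStructure.Aut := ⟨hyperbolicHomeomorph, hyperbolicHomeomorph_mem_aut⟩

/-- The image in `ℝ³ ⧸ lattice` of the axis that `hyperbolicMap` expands. -/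
def expandedAxis (y : ℝ) : Model 3 ⧸ lattice := (!₂[0, y, 0] : Model 3)

theorem continuous_expandedAxis : Continuous expandedAxis :=
  continuous_quot_mk.comp (by fun_prop)

theorem hyperbolicAut_pow_smul_expandedAxis (k : ℕ) (y : ℝ) :
    hyperbolicAut ^ k • expandedAxis y = expandedAxis ((φ ^ 2) ^ k * y) := by
  induction k generalizing y with
  | zero => rw [pow_zero, one_smul, pow_zero, one_mul]
  | succ k ih =>
    have hsmul : hyperbolicAut • expandedAxis y = expandedAxis (φ ^ 2 * y) := by
      change ((hyperbolicMap !₂[0, y, 0] : Model 3) : Model 3 ⧸ lattice) = _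
      simp [hyperbolicMap_apply, expandedAxis]
    rw [pow_succ, mul_smul, hsmul, ih, pow_succ _ k, mul_assoc]

theorem expandedAxis_half_ne_zero : expandedAxis (1 / 2) ≠ expandedAxis 0 := by
  intro h
  obtain ⟨_, p, q, _, h1, h2⟩ := mem_lattice.1 (QuotientAddGroup.eq_iff_sub_mem.1 h)
  replace h1 : (1 / 2 - 0 : ℝ) = p + q * φ := h1
  replace h2 : (0 - 0 : ℝ) = p + q * ψ := h2
  have htrace : (1 : ℝ) = (2 * (2 * p + q) : ℤ) := by
    push_cast
    linear_combination 2 * h1 + 2 * h2 + 2 * q * Real.goldenRatio_add_goldenConj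
  have heven : (1 : ℤ) = 2 * (2 * p + q) := by exact_mod_cast htrace
  omega

theorem halfSpaceStructure_not_autActsProperly : ¬ halfSpaceStructure.AutActsProperly := by
  intro (hproper : ProperSMul halfSpaceStructure.Aut (Model 3 ⧸ lattice))
  have hψ : |ψ ^ 2| < 1 := by
    rw [abs_of_nonneg (sq_nonneg ψ), Real.goldenConj_sq]
    linarith [Real.goldenConj_neg]
  have hu : Tendsto (fun k : ℕ => expandedAxis ((ψ ^ 2) ^ k * (1 / 2))) atTop
      (𝓝 (expandedAxis 0)) := by
    refine (continuous_expandedAxis.tendsto 0).comp ?_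
    simpa only [zero_mul] using
      (tendsto_pow_atTop_nhds_zero_of_abs_lt_one hψ).mul_const (1 / 2 : ℝ)
  have hgu (k : ℕ) : hyperbolicAut ^ k • expandedAxis ((ψ ^ 2) ^ k * (1 / 2)) =
      expandedAxis (1 / 2) := by
    rw [hyperbolicAut_pow_smul_expandedAxis, ← mul_assoc, ← mul_pow, ← mul_pow,
      Real.goldenRatio_mul_goldenConj, neg_one_sq, one_pow, one_mul]
  have hgx (k : ℕ) : hyperbolicAut ^ k • expandedAxis 0 = expandedAxis 0 := by
    rw [hyperbolicAut_pow_smul_expandedAxis, mul_zero]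
  exact expandedAxis_half_ne_zero <| eq_of_tendsto_smul hu
    (tendsto_const_nhds.congr fun k => (hgu k).symm)
    (tendsto_const_nhds.congr fun k => (hgx k).symm)

end RankTwo

end RayManifold

end

open RayManifold in
theorem theorem3 :
    -- rank one: a non-proper automorphism group forces completeness
    (∀ (n : ℕ) (𝒢 : RayGeometry n 1) (M : Type*) (N : Type*)
      [TopologicalSpace M] [ChartedSpace (Model n) M] [IsManifold 𝓘(ℝ, Model n) ∞ M]
      [T2Space M] [CompactSpace M] [ConnectedSpace M]
      [TopologicalSpace N] [ChartedSpace (Model n) N] [IsManifold 𝓘(ℝ, Model n) ∞ N]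
      (π : UniversalCovering n N M) (S : GStructure 𝒢.G π),
      ¬ S.AutActsProperly → S.IsComplete) ∧
    -- rank two: this fails
    (∃ (n : ℕ) (𝒢 : RayGeometry n 2) (M : Type) (N : Type)
      (_ : TopologicalSpace M) (_ : ChartedSpace (Model n) M) (_ : IsManifold 𝓘(ℝ, Model n) ∞ M)
      (_ : T2Space M) (_ : CompactSpace M) (_ : ConnectedSpace M)
      (_ : TopologicalSpace N) (_ : ChartedSpace (Model n) N) (_ : IsManifold 𝓘(ℝ, Model n) ∞ N)
      (π : UniversalCovering n N M) (S : GStructure 𝒢.G π),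
      ¬ S.AutActsProperly ∧ ¬ S.IsComplete) := by
  refine ⟨fun n 𝒢 M N _ _ _ _ _ _ _ _ _ π S h => S.isComplete_of_not_autActsProperly h,
    3, hyperbolicGeometry, Model 3 ⧸ lattice, Model 3, inferInstance, inferInstance,
    inferInstance, inferInstance, inferInstance,
    QuotientAddGroup.mk_surjective.connectedSpace continuous_quot_mk, inferInstance, inferInstance,
    inferInstance, quotientCovering lattice, halfSpaceStructure,
    halfSpaceStructure_not_autActsProperly, halfSpaceStructure_not_isComplete⟩
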